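/- **Theorem (Dual orthogonal sketching).** Fix $\lambda>0$, $\alpha,\sigma\in\mathbb{R}$ and $0<\zeta<\gamma<\infty$. Consider a sequence of linear models $Y=X\beta+\varepsilon$ with $X\in\mathbb{R}^{n\times p}$, where $X$ and $\varepsilon$ are independent, $\beta$ is independent of $(X,\varepsilon)$, and - $X$ has iid standard normal entries; - $\beta\in\mathbb{R}^p$ has iid entries with $\mathbb{E}\beta_i=0$ and $\mathrm{Var}(\beta_i)=\alpha^2/p$; - the noise satisfies $\mathbb{E}\varepsilon=0$ and $\mathrm{Cov}(\varepsilon)=\sigma^2I_n$. Let $R\in\mathbb{R}^{p\times d}$ be a sketching matrix with $R^\top R=I_d$ (so $d\le p$), deterministic or random and independent of $(X,\beta,\varepsilon)$, and consider the dual sketched ridge estimator $$\hat\beta_d(\lambda)=\frac1n X^\top\left(\frac1n XRR^\top X^\top+\lambda I_n\right)^{-1}Y .$$ Let $n,p,d\to\infty$ with $p/n\to\gamma$ and $d/n\to\zeta$. Then the mean squared error $M(\hat\beta_d(\lambda))=\mathbb{E}\|\hat\beta_d(\lambda)-\beta\|_2^2$ is finite, and $$\lim M(\hat\beta_d(\lambda))=\frac{\alpha^2}{\gamma}\left[\gamma-1+(\lambda-\gamma+\zeta)^2\,\bar\theta_2(\zeta,\lambda)+(\gamma-\zeta)\,\bar\theta_1(\zeta,\lambda)^2\right]+\sigma^2\left[\bar\theta_1(\zeta,\lambda)-(\lambda+\zeta-\gamma)\,\bar\theta_2(\zeta,\lambda)\right],$$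 where $\bar\theta_i(\zeta,\lambda)=\dfrac{1-\zeta}{\lambda^i}+\zeta\displaystyle\int\frac{dF_\zeta(x)}{(x+\lambda)^i}$ and $F_\zeta$ is the standard Marchenko–Pastur law with aspect ratio $\zeta$, that is, the probability measure $$F_\zeta=\max(1-1/\zeta,0)\,\delta_0+\frac{\sqrt{(b-x)(x-a)}}{2\pi\zeta x}\,\mathbf 1_{[a,b]}(x)\,dx,\qquad a=(1-\sqrt\zeta)^2,\quad b=(1+\sqrt\zeta)^2 .$$ -/

import Mathlib

open MeasureTheory ProbabilityTheory Filter Topology Matrix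

noncomputable section

namespace DualSketch

/-- Left edge `(1 - √γ)²` of the bulk of the Marchenko–Pastur law with aspect ratio `γ`. -/
def mpLeft (γ : ℝ) : ℝ := (1 - Real.sqrt γ) ^ 2

/-- Right edge `(1 + √γ)²` of the bulk of the Marchenko–Pastur law with aspect ratio `γ`. -/
def mpRight (γ : ℝ) : ℝ := (1 + Real.sqrt γ) ^ 2

/-- Density of the absolutely continuous part of the standard Marchenko–Pastur law. -/
def mpDensity (γ x : ℝ) : ℝ :=
  (Set.Icc (mpLeft γ) (mpRight γ)).indicator
    (fun x => Real.sqrt ((mpRight γ - x) * (x - mpLeft γ)) / (2 * Real.pi * γ * x)) x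

/-- The standard Marchenko–Pastur law `F_γ` (identity covariance, aspect ratio `γ > 0`):
an atom of mass `max (1 - 1/γ) 0` at the origin plus the absolutely continuous part. -/
def marchenkoPastur (γ : ℝ) : Measure ℝ :=
  ENNReal.ofReal (1 - 1 / γ) • Measure.dirac 0
    + volume.withDensity (fun x => ENNReal.ofReal (mpDensity γ x))

/-- Resolvent moment `θ_i(γ, lam) = ∫ (x + lam)^{-i} dF_γ(x)`. -/
def theta (i : ℕ) (γ lam : ℝ) : ℝ := ∫ x, ((x + lam) ^ i)⁻¹ ∂(marchenkoPastur γ)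

/-- Companion resolvent moment
`θ̄_i(ζ, lam) = (1 - ζ) / lam^i + ζ ∫ (x + lam)^{-i} dF_ζ(x)`. -/
def thetaBar (i : ℕ) (ζ lam : ℝ) : ℝ := (1 - ζ) / lam ^ i + ζ * theta i ζ lam

/-- The dual sketched ridge regression estimator
`n⁻¹ Xᵀ (X R Rᵀ Xᵀ / n + lam I)⁻¹ Y`. -/
def dualSketchedRidge {n p d : ℕ} (X : Matrix (Fin n) (Fin p) ℝ)
    (R : Matrix (Fin p) (Fin d) ℝ) (Y : Fin n → ℝ) (lam : ℝ) : Fin p → ℝ :=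
  (n : ℝ)⁻¹ • (Xᵀ *ᵥ
    (((n : ℝ)⁻¹ • (X * R * Rᵀ * Xᵀ) + lam • (1 : Matrix (Fin n) (Fin n) ℝ))⁻¹ *ᵥ Y))

/-- Squared Euclidean estimation error `‖β̂_d - β‖²` of the dual sketched ridge estimator
computed from the response `Y = X β + ε`. -/
def squaredError {n p d : ℕ} (X : Matrix (Fin n) (Fin p) ℝ) (R : Matrix (Fin p) (Fin d) ℝ)
    (β : Fin p → ℝ) (ε : Fin n → ℝ) (lam : ℝ) : ℝ :=
  ∑ j, (dualSketchedRidge X R (X *ᵥ β + ε) lam j - β j) ^ 2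

/-- Real matrices carry the product (entrywise Borel) sigma-algebra. -/
instance matrixMeasurableSpace {m n : Type*} : MeasurableSpace (Matrix m n ℝ) :=
  inferInstanceAs (MeasurableSpace (m → n → ℝ))

/-- The Gaussian random-effects linear model `Y = X β + ε` with an orthogonal sketching
matrix `R`. The columns of `R` are orthonormal; `R` may be deterministic, or random and
independent of the data. Neither the coefficients nor the noise need be Gaussian. -/
structure IsModel {Ω : Type*} [MeasurableSpace Ω] (P : Measure Ω) {n p d : ℕ}
    (X : Ω → Matrix (Fin n) (Fin p) ℝ) (R : Ω → Matrix (Fin p) (Fin d) ℝ)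
    (β : Ω → Fin p → ℝ) (ε : Ω → Fin n → ℝ) (α σ : ℝ) : Prop where
  measurable_X : Measurable X
  measurable_R : Measurable R
  measurable_β : Measurable β
  measurable_ε : Measurable ε
  /-- the entries of `X` are standard normal -/
  X_gaussian : ∀ i j, P.map (fun ω => X ω i j) = gaussianReal 0 1
  /-- the entries of `X` are independent -/
  X_indep : iIndepFun (fun (ij : Fin n × Fin p) ω => X ω ij.1 ij.2) P
  /-- the entries of `β` are iid with mean zero and variance `α² / p` -/
  β_indep : iIndepFun (fun j ω => β ω j) P
  β_ident : ∀ i j, IdentDistrib (fun ω => β ω i) (fun ω => β ω j) P P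
  β_memLp : ∀ j, MemLp (fun ω => β ω j) 2 P
  β_mean : ∀ j, ∫ ω, β ω j ∂P = 0
  β_var : ∀ j, variance (fun ω => β ω j) P = α ^ 2 / p
  /-- the noise has mean zero and covariance `σ² I` -/
  ε_memLp : ∀ i, MemLp (fun ω => ε ω i) 2 P
  ε_mean : ∀ i, ∫ ω, ε ω i ∂P = 0
  ε_cov : ∀ i j, covariance (fun ω => ε ω i) (fun ω => ε ω j) P = if i = j then σ ^ 2 else 0
  /-- design and noise are independent -/
  indep_X_ε : IndepFun X ε P
  /-- the coefficients are independent of design and noise -/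
  indep_β : IndepFun β (fun ω => (X ω, ε ω)) P
  /-- the sketch is independent of the data -/
  indep_R : IndepFun R (fun ω => (X ω, β ω, ε ω)) P
  /-- the sketching matrix has orthonormal columns -/
  R_orthogonal : ∀ᵐ ω ∂P, (R ω)ᵀ * R ω = 1

end DualSketch

end

namespace DualSketch

/-! ### Functions with finite moments of all orders -/

/-! Write Q for the resolvent at `lam` of the sketched covariance A = n⁻¹ X R Rᵀ Xᵀ. The error is
(n⁻¹ Xᵀ Q X - 1) β + n⁻¹ Xᵀ Q ε. Given (X, R), the coordinates of β and ε are centred and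
uncorrelated, so the expected squared error is α²/p and σ² times two squared Frobenius norms
(`condRisk`).

Complete R to an orthogonal matrix. By rotation invariance the d columns of X R and the m = p - d
complementary columns are independent standard Gaussian vectors, whatever R is. If B is the
covariance of the complementary columns, then n⁻¹ X Xᵀ = A + B and Q A = 1 - lam Q. Both norms
thereby reduce to traces of Q, Q², Q²B and QBQB (`condRisk_eq_splitRisk`). Since B is independent of
Q, integrating over B is a moment computation of degree four in Gaussian vectors
(`integral_trace_mul_gram_sq`). Only the moments of s = tr Q / n and s₂ = tr Q² / n remain
(`integral_splitRisk`). The fourth Gaussian moment `kurt` enters these bounds and formulas only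
through terms that vanish in the limit, so its value is never needed.

The limit of s comes from a leave-one-out argument. By Sherman–Morrison, 1 - lam s is the sum of
q/(1+q) over the d columns, divided by n, where q is a quadratic form of a column in the resolvent
of the others. Each q is close to s in L², so s almost solves 1 - lam m - ζ m/(1+m) = 0. This
equation is stable, hence s tends to its positive root `mpRoot` in L²
(`integral_sq_stieltjes_sub_le`). Explicit integration of the Marchenko–Pastur density identifies
the root with `thetaBar 1` (`thetaBar_one_eq`).

Finally s₂ and `thetaBar 2` are minus the derivatives in `lam` of s and `thetaBar 1`. Second-order
Taylor bounds uniform in the dimension carry the convergence over to these derivatives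
(`tendsto_of_slope_bound`). -/

/-- `f` has finite moments of all orders under `μ`. -/
def FiniteMoments {Ω : Type*} [MeasurableSpace Ω] (f : Ω → ℝ) (μ : Measure Ω) : Prop :=
  ∀ q : NNReal, MemLp f q μ

namespace FiniteMoments

variable {Ω Ω' : Type*} [MeasurableSpace Ω] [MeasurableSpace Ω'] {μ : Measure Ω}
  {ν : Measure Ω'} {f g : Ω → ℝ}

theorem integrable (hf : FiniteMoments f μ) : Integrable f μ :=
  memLp_one_iff_integrable.1 (by simpa using hf 1)

theorem add (hf : FiniteMoments f μ) (hg : FiniteMoments g μ) :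
    FiniteMoments (fun ω => f ω + g ω) μ := fun q => (hf q).add (hg q)

theorem sub (hf : FiniteMoments f μ) (hg : FiniteMoments g μ) :
    FiniteMoments (fun ω => f ω - g ω) μ := fun q => (hf q).sub (hg q)

/-- Hölder with exponents 2q and 2q. Closure under products is the reason for asking for all orders
at once: any polynomial in Gaussian entries and bounded resolvent entries is then integrable. -/
theorem mul (hf : FiniteMoments f μ) (hg : FiniteMoments g μ) :
    FiniteMoments (fun ω => f ω * g ω) μ := by
  intro q
  have : ENNReal.HolderTriple ((2 * q : NNReal) : ENNReal) ((2 * q : NNReal) : ENNReal) q := by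
    constructor
    push_cast
    rw [ENNReal.mul_inv (by simp) (by simp), ← add_mul, ENNReal.inv_two_add_inv_two, one_mul]
  exact MemLp.mul (hg (2 * q)) (hf (2 * q))

theorem const [IsFiniteMeasure μ] (c : ℝ) : FiniteMoments (fun _ => c) μ :=
  fun _ => memLp_const c

theorem const_mul (hf : FiniteMoments f μ) (c : ℝ) :
    FiniteMoments (fun ω => c * f ω) μ := fun q => (hf q).const_mul c

theorem pow [IsFiniteMeasure μ] (hf : FiniteMoments f μ) (k : ℕ) :
    FiniteMoments (fun ω => f ω ^ k) μ := by
  induction k with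
  | zero => simpa using const 1
  | succ k ih => simpa only [pow_succ] using ih.mul hf

theorem sum {ι : Type*} (s : Finset ι) {f : ι → Ω → ℝ} (hf : ∀ i, FiniteMoments (f i) μ) :
    FiniteMoments (fun ω => ∑ i ∈ s, f i ω) μ :=
  fun q => memLp_finsetSum s fun i _ => hf i q

theorem of_bound [IsFiniteMeasure μ] (hf : Measurable f) (C : ℝ) (h : ∀ ω, |f ω| ≤ C) :
    FiniteMoments f μ :=
  fun _ => MemLp.of_bound hf.aestronglyMeasurable C (Eventually.of_forall h)

theorem comp {φ : Ω' → Ω} (hf : FiniteMoments f μ) (hφ : MeasurePreserving φ ν μ) :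
    FiniteMoments (fun ω => f (φ ω)) ν :=
  fun q => (hf q).comp_measurePreserving hφ

end FiniteMoments

/-! ### Standard Gaussian vectors -/

/-- The standard Gaussian measure on `ι → ℝ`. -/
noncomputable def stdNormal (ι : Type*) [Fintype ι] : Measure (ι → ℝ) :=
  Measure.pi fun _ => gaussianReal 0 1

instance {ι : Type*} [Fintype ι] : IsProbabilityMeasure (stdNormal ι) := by
  unfold stdNormal; infer_instance

variable {ι κ : Type*} [Fintype ι] [Fintype κ]

/-- The characteristic function of the image at t is that of the Gaussian at Uᵀt, and ‖Uᵀt‖ = ‖t‖.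
Only the rows of U need be orthonormal, so U may be rectangular. -/
theorem stdNormal_map_mulVec [DecidableEq κ] (U : Matrix κ ι ℝ) (hU : U * Uᵀ = 1) :
    (stdNormal ι).map (fun x => U *ᵥ x) = stdNormal κ := by
  have hm : Measurable fun x : ι → ℝ => U *ᵥ x :=
    (Continuous.matrix_mulVec continuous_const continuous_id).measurable
  -- Characteristic functions need an inner product, so the comparison takes place in
  -- `EuclideanSpace` and is pulled back at the end.
  have key : ((stdNormal ι).map (fun x => U *ᵥ x)).map (WithLp.toLp 2)
      = (stdNormal κ).map (WithLp.toLp 2) := by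
    rw [stdNormal, stdNormal, map_pi_eq_stdGaussian, Measure.map_map (by fun_prop) hm]
    apply Measure.ext_of_charFun (E := EuclideanSpace ℝ κ)
    ext t
    have e : ∀ x : ι → ℝ, inner ℝ (WithLp.toLp 2 (U *ᵥ x)) t
        = inner ℝ (WithLp.toLp 2 x) (WithLp.toLp 2 (Uᵀ *ᵥ t.ofLp) : EuclideanSpace ℝ ι) := by
      intro x
      simp only [EuclideanSpace.inner_eq_star_dotProduct, star_trivial]
      rw [dotProduct_mulVec, mulVec_transpose]
    have h2 := charFun_stdGaussian (WithLp.toLp 2 (Uᵀ *ᵥ t.ofLp) : EuclideanSpace ℝ ι)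
    rw [← map_pi_eq_stdGaussian, charFun_apply, integral_map (by fun_prop)
      (Measurable.aestronglyMeasurable (by fun_prop))] at h2
    rw [charFun_stdGaussian, charFun_apply, integral_map
      (Measurable.aemeasurable ((by fun_prop : Measurable (WithLp.toLp 2)).comp hm))
      (Measurable.aestronglyMeasurable (by fun_prop))]
    simp only [Function.comp_apply, e]
    rw [h2]
    congr 3
    norm_cast
    have : ‖(WithLp.toLp 2 (Uᵀ *ᵥ t.ofLp) : EuclideanSpace ℝ ι)‖ ^ 2 = ‖t‖ ^ 2 := by
      rw [← real_inner_self_eq_norm_sq, ← real_inner_self_eq_norm_sq]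
      simp only [EuclideanSpace.inner_eq_star_dotProduct, star_trivial]
      rw [dotProduct_mulVec, vecMul_transpose, mulVec_mulVec, hU, one_mulVec]
    rw [this]
  have hid : ∀ m : Measure (κ → ℝ), (m.map (WithLp.toLp 2)).map (WithLp.ofLp) = m := by
    intro m
    rw [Measure.map_map (by fun_prop) (by fun_prop)]
    exact Measure.map_id
  rw [← hid (stdNormal κ), ← key, hid]

theorem measurePreserving_mulVec [DecidableEq κ] (U : Matrix κ ι ℝ) (hU : U * Uᵀ = 1) :
    MeasurePreserving (fun x => U *ᵥ x) (stdNormal ι) (stdNormal κ) :=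
  ⟨(Continuous.matrix_mulVec continuous_const continuous_id).measurable,
    stdNormal_map_mulVec U hU⟩

theorem measurePreserving_eval_stdNormal (i : ι) :
    MeasurePreserving (fun x : ι → ℝ => x i) (stdNormal ι) (gaussianReal 0 1) :=
  measurePreserving_eval (fun _ : ι => gaussianReal 0 1) i

theorem finiteMoments_gaussianReal : FiniteMoments (fun x => x) (gaussianReal 0 1) :=
  fun q => memLp_id_gaussianReal q

theorem finiteMoments_eval (i : ι) : FiniteMoments (fun x : ι → ℝ => x i) (stdNormal ι) :=
  finiteMoments_gaussianReal.comp (measurePreserving_eval_stdNormal i)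

/-- The fourth moment of the standard Gaussian. -/
noncomputable def kurt : ℝ := ∫ x, x ^ 4 ∂(gaussianReal 0 1)

theorem integral_sq_gaussianReal : ∫ x, x ^ 2 ∂(gaussianReal 0 1) = 1 := by
  have h := variance_fun_id_gaussianReal (μ := 0) (v := 1)
  rw [variance_of_integral_eq_zero (by fun_prop) (by simp)] at h
  simpa using h

theorem integral_eval_comp (i : ι) (f : ℝ → ℝ) (hf : Measurable f) :
    ∫ x, f (x i) ∂(stdNormal ι) = ∫ x, f x ∂(gaussianReal 0 1) := by
  rw [← (measurePreserving_eval_stdNormal i).map_eq, integral_map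
    (measurePreserving_eval_stdNormal i).measurable.aemeasurable hf.aestronglyMeasurable]

theorem integral_eval_comp_mul {i j : ι} (hij : i ≠ j) (f g : ℝ → ℝ) (hf : Measurable f)
    (hg : Measurable g) :
    ∫ x, f (x i) * g (x j) ∂(stdNormal ι)
      = (∫ x, f x ∂(gaussianReal 0 1)) * ∫ x, g x ∂(gaussianReal 0 1) := by
  have hind : iIndepFun (fun (i : ι) (x : ι → ℝ) => x i) (stdNormal ι) :=
    iIndepFun_pi (X := fun _ x => x) (fun i => by fun_prop)
  have h := (hind.indepFun hij).comp hf hg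
  rw [← integral_eval_comp i f hf, ← integral_eval_comp j g hg]
  exact h.integral_fun_mul_eq_mul_integral
    (hf.comp (measurable_pi_apply i)).aestronglyMeasurable
    (hg.comp (measurable_pi_apply j)).aestronglyMeasurable

theorem integral_eval_mul_eval [DecidableEq ι] (i j : ι) :
    ∫ x, x i * x j ∂(stdNormal ι) = if i = j then 1 else 0 := by
  split_ifs with h
  · subst h
    rw [← integral_sq_gaussianReal, ← integral_eval_comp i (fun x => x ^ 2) (by fun_prop)]
    simp only [sq]
  · rw [integral_eval_comp_mul h (fun x => x) (fun x => x) (by fun_prop) (by fun_prop)]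
    have : ∫ x, x ∂(gaussianReal 0 1) = 0 := integral_id_gaussianReal
    simp [this]

theorem integral_sq_mul_sq [DecidableEq ι] (i j : ι) :
    ∫ x, x i ^ 2 * x j ^ 2 ∂(stdNormal ι) = if i = j then kurt else 1 := by
  split_ifs with h
  · subst h
    rw [kurt, ← integral_eval_comp i (fun x => x ^ 4) (by fun_prop)]
    congr 1; ext x; ring
  · rw [integral_eval_comp_mul h (fun x => x ^ 2) (fun x => x ^ 2) (by fun_prop) (by fun_prop),
      integral_sq_gaussianReal, mul_one]

/-! ### Quadratic forms in Gaussian vectors -/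

theorem dotProduct_mulVec_eq_sum (M : Matrix ι ι ℝ) (x : ι → ℝ) :
    x ⬝ᵥ M *ᵥ x = ∑ i, ∑ j, M i j * (x i * x j) := by
  simp only [dotProduct, mulVec, Finset.mul_sum]
  exact Finset.sum_congr rfl fun i _ => Finset.sum_congr rfl fun j _ => by ring

theorem finiteMoments_quadForm (M : Matrix ι ι ℝ) :
    FiniteMoments (fun x => x ⬝ᵥ M *ᵥ x) (stdNormal ι) := by
  simp only [dotProduct_mulVec_eq_sum]
  exact .sum _ fun i => .sum _ fun j =>
    ((finiteMoments_eval i).mul (finiteMoments_eval j)).const_mul _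

theorem integral_quadForm (M : Matrix ι ι ℝ) :
    ∫ x, x ⬝ᵥ M *ᵥ x ∂(stdNormal ι) = M.trace := by
  classical
  simp only [dotProduct_mulVec_eq_sum]
  have h : ∀ i j, FiniteMoments (fun x : ι → ℝ => M i j * (x i * x j)) (stdNormal ι) :=
    fun i j => ((finiteMoments_eval i).mul (finiteMoments_eval j)).const_mul _
  rw [integral_finsetSum _ fun i _ => (FiniteMoments.sum _ fun j => h i j).integrable]
  simp only [trace, diag]
  refine Finset.sum_congr rfl fun i _ => ?_
  rw [integral_finsetSum _ fun j _ => (h i j).integrable]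
  simp [integral_const_mul, integral_eval_mul_eval]

/-- Distinct indices contribute e i * e j and equal ones `kurt` * e i ^ 2; the factor `kurt - 1`
corrects the diagonal of the full double sum. -/
theorem integral_sq_sum_smul_sq (e : ι → ℝ) :
    ∫ x, (∑ i, e i * x i ^ 2) ^ 2 ∂(stdNormal ι)
      = (∑ i, e i) ^ 2 + (kurt - 1) * ∑ i, e i ^ 2 := by
  classical
  have h : ∀ i j, FiniteMoments (fun x : ι → ℝ => e i * e j * (x i ^ 2 * x j ^ 2))
      (stdNormal ι) := fun i j =>
    (((finiteMoments_eval i).pow 2).mul ((finiteMoments_eval j).pow 2)).const_mul _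
  have e1 : ∀ x : ι → ℝ, (∑ i, e i * x i ^ 2) ^ 2
      = ∑ i, ∑ j, e i * e j * (x i ^ 2 * x j ^ 2) := by
    intro x
    rw [sq, Finset.sum_mul_sum]
    exact Finset.sum_congr rfl fun i _ => Finset.sum_congr rfl fun j _ => by ring
  simp only [e1]
  rw [integral_finsetSum _ fun i _ => (FiniteMoments.sum _ fun j => h i j).integrable, sq,
    Finset.sum_mul_sum, Finset.mul_sum, ← Finset.sum_add_distrib]
  refine Finset.sum_congr rfl fun i _ => ?_
  rw [integral_finsetSum _ fun j _ => (h i j).integrable]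
  have e2 : ∀ j, e i * e j * (if i = j then kurt else 1)
      = e i * e j + (if i = j then (kurt - 1) * e j ^ 2 else 0) := by
    intro j
    split_ifs with hij
    · subst hij; ring
    · ring
  simp only [integral_const_mul, integral_sq_mul_sq, e2, Finset.sum_add_distrib]
  simp

/-- In an orthonormal eigenbasis of M the vector is still standard Gaussian, so the diagonal case
suffices and no mixed fourth moments have to be enumerated. -/
theorem integral_sq_quadForm [DecidableEq ι] (M : Matrix ι ι ℝ) (hM : M.IsHermitian) :
    ∫ x, (x ⬝ᵥ M *ᵥ x) ^ 2 ∂(stdNormal ι)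
      = M.trace ^ 2 + (kurt - 1) * (M * M).trace := by
  set U : Matrix ι ι ℝ := (hM.eigenvectorUnitary : Matrix ι ι ℝ) with hUdef
  have hU1 : U * Uᵀ = 1 := by
    have : U * star U = 1 := Unitary.coe_mul_star_self hM.eigenvectorUnitary
    rwa [star_eq_conjTranspose, conjTranspose_eq_transpose_of_trivial] at this
  have hU2 : Uᵀ * U = 1 := by
    have : star U * U = 1 := Unitary.coe_star_mul_self hM.eigenvectorUnitary
    rwa [star_eq_conjTranspose, conjTranspose_eq_transpose_of_trivial] at this
  have hsp : M = U * diagonal hM.eigenvalues * Uᵀ := by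
    have := hM.spectral_theorem
    simpa [Unitary.conjStarAlgAut_apply, star_eq_conjTranspose,
      conjTranspose_eq_transpose_of_trivial, Function.comp_def] using this
  set e := hM.eigenvalues
  have hq : ∀ x, (x ⬝ᵥ M *ᵥ x) = ∑ i, e i * ((Uᵀ *ᵥ x) i) ^ 2 := by
    intro x
    rw [hsp, ← mulVec_mulVec, ← mulVec_mulVec, dotProduct_mulVec, ← mulVec_transpose,
      dotProduct]
    refine Finset.sum_congr rfl fun i _ => ?_
    rw [mulVec_diagonal]; ring
  have htr : M.trace = ∑ i, e i := by
    rw [hsp, trace_mul_comm, ← mul_assoc, hU2, one_mul, trace_diagonal]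
  have htr2 : (M * M).trace = ∑ i, e i ^ 2 := by
    have : M * M = U * (diagonal e * diagonal e) * Uᵀ := by
      rw [hsp]
      calc _ = U * diagonal e * (Uᵀ * U) * diagonal e * Uᵀ := by simp only [mul_assoc]
        _ = _ := by rw [hU2, mul_one]; simp only [mul_assoc]
    rw [this, trace_mul_comm, ← mul_assoc, hU2, one_mul, diagonal_mul_diagonal, trace_diagonal]
    simp only [sq]
  have hp := measurePreserving_mulVec Uᵀ (by rw [transpose_transpose, hU2])
  simp only [hq]
  rw [htr, htr2, ← integral_sq_sum_smul_sq]
  conv_rhs => rw [← hp.map_eq]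
  rw [integral_map hp.measurable.aemeasurable (Measurable.aestronglyMeasurable (by fun_prop))]

end DualSketch

namespace DualSketch

/-! ### The resolvent of a positive semidefinite matrix -/

section Resolvent

set_option linter.unusedSectionVars false

variable {ι κ : Type*} [Fintype ι] [Fintype κ] [DecidableEq ι]

/-- The resolvent `(A + lam I)⁻¹`. -/
noncomputable def resolvent (A : Matrix ι ι ℝ) (lam : ℝ) : Matrix ι ι ℝ :=
  (A + lam • (1 : Matrix ι ι ℝ))⁻¹

variable {A : Matrix ι ι ℝ} {lam : ℝ}

theorem posDef_add_smul_one (hA : A.PosSemidef) (hlam : 0 < lam) :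
    (A + lam • (1 : Matrix ι ι ℝ)).PosDef :=
  PosDef.posSemidef_add hA (PosDef.one.smul hlam)

theorem isUnit_det_add_smul_one (hA : A.PosSemidef) (hlam : 0 < lam) :
    IsUnit (A + lam • (1 : Matrix ι ι ℝ)).det :=
  (isUnit_iff_isUnit_det _).1 (posDef_add_smul_one hA hlam).isUnit

theorem add_mul_resolvent (hA : A.PosSemidef) (hlam : 0 < lam) :
    (A + lam • (1 : Matrix ι ι ℝ)) * resolvent A lam = 1 :=
  mul_nonsing_inv _ (isUnit_det_add_smul_one hA hlam)

theorem resolvent_mul_add (hA : A.PosSemidef) (hlam : 0 < lam) :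
    resolvent A lam * (A + lam • (1 : Matrix ι ι ℝ)) = 1 :=
  nonsing_inv_mul _ (isUnit_det_add_smul_one hA hlam)

theorem mul_resolvent (hA : A.PosSemidef) (hlam : 0 < lam) :
    A * resolvent A lam = 1 - lam • resolvent A lam := by
  have := add_mul_resolvent hA hlam
  rw [add_mul, Matrix.smul_mul, one_mul] at this
  exact eq_sub_of_add_eq this

theorem resolvent_mul (hA : A.PosSemidef) (hlam : 0 < lam) :
    resolvent A lam * A = 1 - lam • resolvent A lam := by
  have := resolvent_mul_add hA hlam
  rw [mul_add, Matrix.mul_smul, mul_one] at this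
  exact eq_sub_of_add_eq this

theorem posSemidef_resolvent (hA : A.PosSemidef) (hlam : 0 < lam) :
    (resolvent A lam).PosSemidef :=
  (posDef_add_smul_one hA hlam).inv.posSemidef

theorem transpose_resolvent (hA : A.PosSemidef) (hlam : 0 < lam) :
    (resolvent A lam)ᵀ = resolvent A lam := by
  have := (posSemidef_resolvent hA hlam).isHermitian
  rwa [IsHermitian, conjTranspose_eq_transpose_of_trivial] at this

/-- With Q the resolvent, this matrix is Q A Q. -/
theorem posSemidef_resolvent_sub (hA : A.PosSemidef) (hlam : 0 < lam) :
    (resolvent A lam - lam • (resolvent A lam * resolvent A lam)).PosSemidef := by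
  have h := hA.conjTranspose_mul_mul_same (resolvent A lam)
  rwa [conjTranspose_eq_transpose_of_trivial, transpose_resolvent hA hlam, mul_assoc,
    mul_resolvent hA hlam, mul_sub, mul_one, Matrix.mul_smul] at h

/-- Decompose 1 - lam Q = (1 - lam Q)² + lam (Q - lam Q²), a sum of two positive semidefinite
matrices. -/
theorem posSemidef_one_sub_resolvent (hA : A.PosSemidef) (hlam : 0 < lam) :
    (1 - lam • resolvent A lam).PosSemidef := by
  have h1 := (posSemidef_resolvent_sub hA hlam).smul hlam.le
  have h2 := posSemidef_conjTranspose_mul_self (1 - lam • resolvent A lam)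
  have h3 := h2.add h1
  rw [conjTranspose_eq_transpose_of_trivial, transpose_sub, transpose_one, transpose_smul,
    transpose_resolvent hA hlam] at h3
  convert h3 using 1
  simp only [mul_sub, sub_mul, mul_one, one_mul, Matrix.smul_mul, Matrix.mul_smul, smul_sub]
  abel

theorem quadForm_resolvent_nonneg (hA : A.PosSemidef) (hlam : 0 < lam) (v : ι → ℝ) :
    0 ≤ v ⬝ᵥ resolvent A lam *ᵥ v := by
  simpa using (posSemidef_resolvent hA hlam).dotProduct_mulVec_nonneg v

theorem quadForm_sq_resolvent_le (hA : A.PosSemidef) (hlam : 0 < lam) (v : ι → ℝ) :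
    lam * (v ⬝ᵥ (resolvent A lam * resolvent A lam) *ᵥ v) ≤ v ⬝ᵥ resolvent A lam *ᵥ v := by
  have h := (posSemidef_resolvent_sub hA hlam).dotProduct_mulVec_nonneg v
  simp only [star_trivial, sub_mulVec, smul_mulVec, dotProduct_sub, dotProduct_smul,
    smul_eq_mul] at h
  linarith

theorem quadForm_sq_resolvent_nonneg (hA : A.PosSemidef) (hlam : 0 < lam) (v : ι → ℝ) :
    0 ≤ v ⬝ᵥ (resolvent A lam * resolvent A lam) *ᵥ v := by
  have h := (posSemidef_conjTranspose_mul_self (resolvent A lam)).dotProduct_mulVec_nonneg v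
  rwa [conjTranspose_eq_transpose_of_trivial, transpose_resolvent hA hlam, star_trivial] at h

theorem trace_resolvent_nonneg (hA : A.PosSemidef) (hlam : 0 < lam) :
    0 ≤ (resolvent A lam).trace := (posSemidef_resolvent hA hlam).trace_nonneg

theorem trace_resolvent_le (hA : A.PosSemidef) (hlam : 0 < lam) :
    (resolvent A lam).trace ≤ Fintype.card ι / lam := by
  have h := (posSemidef_one_sub_resolvent hA hlam).trace_nonneg
  rw [trace_sub, trace_one, trace_smul, smul_eq_mul] at h
  rw [le_div_iff₀ hlam]; linarith

theorem trace_sq_resolvent_nonneg (hA : A.PosSemidef) (hlam : 0 < lam) :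
    0 ≤ (resolvent A lam * resolvent A lam).trace := by
  have h := (posSemidef_conjTranspose_mul_self (resolvent A lam)).trace_nonneg
  rwa [conjTranspose_eq_transpose_of_trivial, transpose_resolvent hA hlam] at h

theorem trace_sq_resolvent_le (hA : A.PosSemidef) (hlam : 0 < lam) :
    (resolvent A lam * resolvent A lam).trace ≤ Fintype.card ι / lam ^ 2 := by
  have h := (posSemidef_resolvent_sub hA hlam).trace_nonneg
  rw [trace_sub, trace_smul, smul_eq_mul] at h
  have h2 := trace_resolvent_le hA hlam
  rw [le_div_iff₀ hlam] at h2
  rw [le_div_iff₀ (by positivity)]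
  nlinarith

/-- An entry is at most the Frobenius norm. The bound does not depend on A, so the entries of a
random resolvent have all moments. -/
theorem abs_resolvent_apply_le (hA : A.PosSemidef) (hlam : 0 < lam) (i j : ι) :
    |resolvent A lam i j| ≤ √(Fintype.card ι / lam ^ 2) := by
  apply Real.abs_le_sqrt
  refine le_trans ?_ (trace_sq_resolvent_le hA hlam)
  have h : (resolvent A lam * resolvent A lam).trace
      = ∑ i, ∑ j, resolvent A lam i j ^ 2 := by
    nth_rw 2 [← transpose_resolvent hA hlam]
    simp only [trace, diag, mul_apply, transpose_apply, sq]
  rw [h]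
  refine le_trans ?_ (Finset.single_le_sum (f := fun i => ∑ j, resolvent A lam i j ^ 2)
    (fun i _ => by positivity) (Finset.mem_univ i))
  exact Finset.single_le_sum (f := fun j => resolvent A lam i j ^ 2)
    (fun i _ => by positivity) (Finset.mem_univ j)

/-- Second-order Taylor bound in the regularization. The resolvent identity Q - Q' = (mu - lam) Q
Q', used twice, leaves the remainder (mu - lam)² tr(Q Q' Q), and mu Q' ≤ 1. The bound is linear in
the dimension, hence uniform for normalized traces. -/
theorem trace_resolvent_sub (hA : A.PosSemidef) {mu : ℝ} (hlam : 0 < lam) (hmu : 0 < mu) :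
    |(resolvent A lam).trace - (resolvent A mu).trace
        - (mu - lam) * (resolvent A lam * resolvent A lam).trace|
      ≤ (mu - lam) ^ 2 * (Fintype.card ι / (lam ^ 2 * mu)) := by
  set Q := resolvent A lam
  set Q' := resolvent A mu
  have e1 : Q - Q' = (mu - lam) • (Q * Q') := by
    calc Q - Q' = Q * ((A + mu • (1 : Matrix ι ι ℝ)) * Q')
          - (Q * (A + lam • (1 : Matrix ι ι ℝ))) * Q' := by
            rw [add_mul_resolvent hA hmu, resolvent_mul_add hA hlam, mul_one, one_mul]
      _ = _ := by
            simp only [add_mul, mul_add, Matrix.smul_mul, Matrix.mul_smul, mul_one, one_mul, mul_assoc, sub_smul]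
            abel
  have e2 : Q.trace - Q'.trace - (mu - lam) * (Q * Q).trace
      = - ((mu - lam) ^ 2 * (Q * Q' * Q).trace) := by
    rw [← trace_sub, e1, trace_smul, smul_eq_mul, ← mul_sub, ← trace_sub, ← mul_sub]
    have : Q' - Q = - ((mu - lam) • (Q * Q')) := by rw [← e1]; abel
    rw [this, mul_neg, Matrix.mul_smul, trace_neg, trace_smul, trace_mul_comm Q (Q * Q'), smul_eq_mul]
    ring
  have h1 := ((posSemidef_resolvent hA hmu).conjTranspose_mul_mul_same Q).trace_nonneg
  have h2 := ((posSemidef_one_sub_resolvent hA hmu).conjTranspose_mul_mul_same Q).trace_nonneg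
  rw [conjTranspose_eq_transpose_of_trivial, transpose_resolvent hA hlam] at h1 h2
  rw [mul_sub, sub_mul, mul_one, Matrix.mul_smul, Matrix.smul_mul, trace_sub, trace_smul, smul_eq_mul] at h2
  have h3 := trace_sq_resolvent_le hA hlam
  rw [e2, abs_neg, abs_of_nonneg (mul_nonneg (sq_nonneg _) h1)]
  refine mul_le_mul_of_nonneg_left ?_ (sq_nonneg _)
  rw [le_div_iff₀ (by positivity)] at h3 ⊢
  have : mu * (Q * Q' * Q).trace ≤ (Q * Q).trace := by linarith
  calc _ = (mu * (Q * Q' * Q).trace) * lam ^ 2 := by ring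
    _ ≤ (Q * Q).trace * lam ^ 2 := mul_le_mul_of_nonneg_right this (sq_nonneg _)
    _ ≤ _ := h3

theorem posSemidef_add_rankOne (hA : A.PosSemidef) {c : ℝ} (hc : 0 ≤ c) (v : ι → ℝ) :
    (A + c • vecMulVec v v).PosSemidef := by
  refine hA.add (PosSemidef.smul ?_ hc)
  simpa using posSemidef_vecMulVec_self_star v

/-- Sherman–Morrison, applied to v only: the perturbed matrix sends Q v to (1 + c vᵀQv) v. -/
theorem resolvent_rankOne_mulVec (hA : A.PosSemidef) (hlam : 0 < lam) {c : ℝ} (hc : 0 ≤ c)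
    (v : ι → ℝ) :
    resolvent (A + c • vecMulVec v v) lam *ᵥ v
      = (1 + c * (v ⬝ᵥ resolvent A lam *ᵥ v))⁻¹ • (resolvent A lam *ᵥ v) := by
  have hq := mul_nonneg hc (quadForm_resolvent_nonneg hA hlam v)
  set q := c * (v ⬝ᵥ resolvent A lam *ᵥ v) with hqdef
  have h1 : (A + c • vecMulVec v v + lam • (1 : Matrix ι ι ℝ)) *ᵥ (resolvent A lam *ᵥ v)
      = (1 + q) • v := by
    have : A + c • vecMulVec v v + lam • (1 : Matrix ι ι ℝ)
      = (A + lam • (1 : Matrix ι ι ℝ)) + c • vecMulVec v v := by abel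
    rw [this, add_mulVec, mulVec_mulVec, add_mul_resolvent hA hlam, one_mulVec, smul_mulVec,
      vecMulVec_mulVec, add_smul, one_smul, hqdef]
    simp [smul_smul]
  have h2 := congrArg (fun w => resolvent (A + c • vecMulVec v v) lam *ᵥ w) h1
  rw [mulVec_mulVec, resolvent_mul_add (posSemidef_add_rankOne hA hc v) hlam, one_mulVec,
    mulVec_smul] at h2
  rw [h2, smul_smul, inv_mul_cancel₀ (by positivity), one_smul]

theorem quadForm_resolvent_rankOne (hA : A.PosSemidef) (hlam : 0 < lam) {c : ℝ} (hc : 0 ≤ c)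
    (v : ι → ℝ) :
    c * (v ⬝ᵥ resolvent (A + c • vecMulVec v v) lam *ᵥ v)
      = c * (v ⬝ᵥ resolvent A lam *ᵥ v) / (1 + c * (v ⬝ᵥ resolvent A lam *ᵥ v)) := by
  rw [resolvent_rankOne_mulVec hA hlam hc, dotProduct_smul, smul_eq_mul]
  ring

/-- The difference equals c vᵀQ²v / (1 + c vᵀQv), and lam Q² ≤ Q. The bound depends neither on v nor
on the dimension, so deleting one column is negligible after division by n. -/
theorem abs_trace_resolvent_rankOne_sub_le (hA : A.PosSemidef) (hlam : 0 < lam) {c : ℝ}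
    (hc : 0 ≤ c) (v : ι → ℝ) :
    |(resolvent A lam).trace - (resolvent (A + c • vecMulVec v v) lam).trace| ≤ 1 / lam := by
  have hq := mul_nonneg hc (quadForm_resolvent_nonneg hA hlam v)
  have hA' := posSemidef_add_rankOne hA hc v
  have h1 : resolvent A lam - resolvent (A + c • vecMulVec v v) lam
      = resolvent (A + c • vecMulVec v v) lam * (c • vecMulVec v v) * resolvent A lam := by
    calc _ = resolvent (A + c • vecMulVec v v) lam
            * (A + c • vecMulVec v v + lam • (1 : Matrix ι ι ℝ)) * resolvent A lam
          - resolvent (A + c • vecMulVec v v) lam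
            * ((A + lam • (1 : Matrix ι ι ℝ)) * resolvent A lam) := by
            rw [add_mul_resolvent hA hlam, resolvent_mul_add hA' hlam, mul_one, one_mul]
      _ = _ := by
            rw [mul_assoc, ← mul_sub, ← sub_mul, mul_assoc]
            congr 2
            abel
  have h2 : (resolvent A lam).trace - (resolvent (A + c • vecMulVec v v) lam).trace
      = c * (v ⬝ᵥ (resolvent A lam * resolvent A lam) *ᵥ v)
        / (1 + c * (v ⬝ᵥ resolvent A lam *ᵥ v)) := by
    rw [← trace_sub, h1, Matrix.mul_smul, Matrix.smul_mul, trace_smul, smul_eq_mul, mul_vecMulVec,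
      resolvent_rankOne_mulVec hA hlam hc, smul_vecMulVec, Matrix.smul_mul, trace_smul, smul_eq_mul,
      vecMulVec_mul, trace_vecMulVec, dotProduct_comm, ← mulVec_transpose,
      transpose_resolvent hA hlam, ← mulVec_mulVec, dotProduct_mulVec v,
      ← mulVec_transpose, transpose_resolvent hA hlam]
    ring
  have h3 := quadForm_sq_resolvent_le hA hlam v
  have h4 := mul_nonneg hc (quadForm_sq_resolvent_nonneg hA hlam v)
  rw [h2, abs_of_nonneg (by positivity), div_le_div_iff₀ (by positivity) hlam]
  nlinarith [mul_le_mul_of_nonneg_left h3 hc]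

/-! ### Measurability and moments of matrix-valued functions -/

variable {Ω : Type*} [MeasurableSpace Ω] {μ : Measure Ω}

theorem measurable_det {f : Ω → Matrix ι ι ℝ} (hf : ∀ i j, Measurable fun ω => f ω i j) :
    Measurable fun ω => (f ω).det := by
  simp only [det_apply]
  exact Finset.measurable_sum _ fun τ _ =>
    (Finset.measurable_prod _ fun i _ => hf _ _).const_smul _

/-- By Cramer's rule an entry is a quotient of determinants; since real inversion is total and
measurable, invertibility plays no role. -/
theorem measurable_resolvent {f : Ω → Matrix ι ι ℝ} (hf : ∀ i j, Measurable fun ω => f ω i j)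
    (lam : ℝ) (i j : ι) : Measurable fun ω => resolvent (f ω) lam i j := by
  have hg : ∀ i j, Measurable fun ω => (f ω + lam • (1 : Matrix ι ι ℝ)) i j := fun i j => by
    simpa using (hf i j).add_const _
  simp only [resolvent, inv_def, Matrix.smul_apply, Ring.inverse_eq_inv, smul_eq_mul, adjugate_apply]
  refine (measurable_det hg).inv.mul (measurable_det fun k l => ?_)
  by_cases h : k = j
  · simp [updateRow_apply, h]
  · simpa [updateRow_apply, h] using hg k l

/-- All entries of a random matrix have finite moments. -/
def FiniteMomentsMat {m n : Type*} (M : Ω → Matrix m n ℝ) (μ : Measure Ω) : Prop :=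
  ∀ i j, FiniteMoments (fun ω => M ω i j) μ

namespace FiniteMomentsMat

variable {m n l : Type*}

theorem add {M N : Ω → Matrix m n ℝ} (hM : FiniteMomentsMat M μ) (hN : FiniteMomentsMat N μ) :
    FiniteMomentsMat (fun ω => M ω + N ω) μ := fun i j => (hM i j).add (hN i j)

theorem sub {M N : Ω → Matrix m n ℝ} (hM : FiniteMomentsMat M μ) (hN : FiniteMomentsMat N μ) :
    FiniteMomentsMat (fun ω => M ω - N ω) μ := fun i j => (hM i j).sub (hN i j)

theorem smul {M : Ω → Matrix m n ℝ} (hM : FiniteMomentsMat M μ) (c : ℝ) :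
    FiniteMomentsMat (fun ω => c • M ω) μ := fun i j => (hM i j).const_mul c

theorem const [IsFiniteMeasure μ] (M : Matrix m n ℝ) : FiniteMomentsMat (fun _ => M) μ :=
  fun _ _ => .const _

theorem transpose {M : Ω → Matrix m n ℝ} (hM : FiniteMomentsMat M μ) :
    FiniteMomentsMat (fun ω => (M ω)ᵀ) μ := fun i j => hM j i

theorem mul [Fintype n] {M : Ω → Matrix m n ℝ} {N : Ω → Matrix n l ℝ}
    (hM : FiniteMomentsMat M μ) (hN : FiniteMomentsMat N μ) :
    FiniteMomentsMat (fun ω => M ω * N ω) μ := fun i j => by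
  simp only [mul_apply]
  exact .sum _ fun k => (hM i k).mul (hN k j)

theorem trace [Fintype m] {M : Ω → Matrix m m ℝ} (hM : FiniteMomentsMat M μ) :
    FiniteMoments (fun ω => (M ω).trace) μ := .sum _ fun i => hM i i

theorem resolvent [IsFiniteMeasure μ] {f : Ω → Matrix ι ι ℝ}
    (hf : ∀ i j, Measurable fun ω => f ω i j) (hpos : ∀ ω, (f ω).PosSemidef) {lam : ℝ}
    (hlam : 0 < lam) : FiniteMomentsMat (fun ω => resolvent (f ω) lam) μ := fun i j =>
  .of_bound (measurable_resolvent hf lam i j) _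
    fun ω => abs_resolvent_apply_le (hpos ω) hlam i j

end FiniteMomentsMat

end Resolvent

/-! ### Sample covariance matrices and the leave-one-out argument -/

section Gram

set_option linter.unusedSectionVars false

variable {ι κ : Type*} [Fintype ι] [Fintype κ] [DecidableEq ι]

/-- Sample covariance matrix `n⁻¹ ∑ₖ zₖ zₖᵀ` of the columns `zₖ ∈ ℝⁿ`. -/
noncomputable def gram (z : κ → ι → ℝ) : Matrix ι ι ℝ :=
  (Fintype.card ι : ℝ)⁻¹ • ∑ k, vecMulVec (z k) (z k)

theorem gram_apply (z : κ → ι → ℝ) (i j : ι) :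
    gram z i j = (Fintype.card ι : ℝ)⁻¹ * ∑ k, z k i * z k j := by
  simp [gram, Matrix.smul_apply, Matrix.sum_apply, vecMulVec_apply]

theorem posSemidef_gram (z : κ → ι → ℝ) : (gram z).PosSemidef := by
  refine PosSemidef.smul (posSemidef_sum _ fun k _ => ?_) (by positivity)
  simpa using posSemidef_vecMulVec_self_star (z k)

theorem measurable_gram (i j : ι) : Measurable fun z : κ → ι → ℝ => gram z i j := by
  simp only [gram_apply]
  fun_prop

theorem trace_mul_gram (M : Matrix ι ι ℝ) (z : κ → ι → ℝ) :
    (M * gram z).trace = (Fintype.card ι : ℝ)⁻¹ * ∑ k, z k ⬝ᵥ M *ᵥ z k := by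
  simp only [gram, Matrix.mul_smul, Matrix.mul_sum, trace_smul, trace_sum, mul_vecMulVec,
    trace_vecMulVec, smul_eq_mul]
  congr 1
  exact Finset.sum_congr rfl fun k _ => dotProduct_comm _ _

/-- The normalization is by the length of the columns and not by their number, so removing a column
is an exact rank-one change without rescaling. -/
theorem gram_succAbove {d : ℕ} (k : Fin (d + 1)) (z : Fin (d + 1) → ι → ℝ) :
    gram z = gram (k.removeNth z)
      + (Fintype.card ι : ℝ)⁻¹ • vecMulVec (z k) (z k) := by
  simp only [gram, Fin.sum_univ_succAbove _ k, smul_add, Fin.removeNth]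
  rw [add_comm]

/-- Law of a matrix with iid standard normal entries, stored by columns. -/
noncomputable def colNormal (κ ι : Type*) [Fintype κ] [Fintype ι] : Measure (κ → ι → ℝ) :=
  Measure.pi fun _ => stdNormal ι

instance : IsProbabilityMeasure (colNormal κ ι) := by unfold colNormal; infer_instance

theorem finiteMoments_colNormal (k : κ) (i : ι) :
    FiniteMoments (fun z : κ → ι → ℝ => z k i) (colNormal κ ι) :=
  (finiteMoments_eval i).comp (measurePreserving_eval (fun _ : κ => stdNormal ι) k)

theorem finiteMomentsMat_resolvent_gram {lam : ℝ} (hlam : 0 < lam) :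
    FiniteMomentsMat (fun z : κ → ι → ℝ => resolvent (gram z) lam) (colNormal κ ι) :=
  .resolvent measurable_gram posSemidef_gram hlam

theorem finiteMoments_quadForm_resolvent {lam : ℝ} (hlam : 0 < lam) :
    FiniteMoments (fun y : (ι → ℝ) × (κ → ι → ℝ) =>
      y.1 ⬝ᵥ resolvent (gram y.2) lam *ᵥ y.1) ((stdNormal ι).prod (colNormal κ ι)) := by
  simp only [dotProduct_mulVec_eq_sum]
  refine .sum _ fun i => .sum _ fun j => .mul ?_ (.mul ?_ ?_)
  · exact (finiteMomentsMat_resolvent_gram hlam i j).comp measurePreserving_snd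
  · exact (finiteMoments_eval i).comp measurePreserving_fst
  · exact (finiteMoments_eval j).comp measurePreserving_fst

theorem integral_sq_quadForm_sub_trace (M : Matrix ι ι ℝ) (hM : M.IsHermitian) :
    ∫ v, (v ⬝ᵥ M *ᵥ v - M.trace) ^ 2 ∂(stdNormal ι) = (kurt - 1) * (M * M).trace := by
  have h := finiteMoments_quadForm M
  have e : ∀ v : ι → ℝ, (v ⬝ᵥ M *ᵥ v - M.trace) ^ 2
      = (v ⬝ᵥ M *ᵥ v) ^ 2 - 2 * M.trace * (v ⬝ᵥ M *ᵥ v) + M.trace ^ 2 := fun v => by ring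
  simp only [e]
  rw [integral_add ((h.pow 2).sub (h.const_mul _)).integrable (integrable_const _),
    integral_sub (h.pow 2).integrable (h.const_mul _).integrable, integral_const_mul,
    integral_sq_quadForm M hM, integral_quadForm]
  simp
  ring

/-- The normalized trace of the resolvent of the sample covariance matrix. -/
noncomputable def stieltjes (lam : ℝ) (z : κ → ι → ℝ) : ℝ :=
  (resolvent (gram z) lam).trace / Fintype.card ι

theorem finiteMoments_stieltjes {lam : ℝ} (hlam : 0 < lam) :
    FiniteMoments (fun z : κ → ι → ℝ => stieltjes lam z) (colNormal κ ι) := by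
  simp only [stieltjes, div_eq_inv_mul]
  exact (finiteMomentsMat_resolvent_gram hlam).trace.const_mul _

theorem stieltjes_nonneg {lam : ℝ} (hlam : 0 < lam) (z : κ → ι → ℝ) : 0 ≤ stieltjes lam z :=
  div_nonneg (trace_resolvent_nonneg (posSemidef_gram z) hlam) (Nat.cast_nonneg _)

/-- The leave-one-out quadratic form of the `k`-th column. -/
noncomputable def looForm {d : ℕ} (lam : ℝ) (k : Fin (d + 1)) (z : Fin (d + 1) → ι → ℝ) : ℝ :=
  (Fintype.card ι : ℝ)⁻¹ * (z k ⬝ᵥ resolvent (gram (k.removeNth z)) lam *ᵥ z k)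

theorem looForm_nonneg {d : ℕ} {lam : ℝ} (hlam : 0 < lam) (k : Fin (d + 1))
    (z : Fin (d + 1) → ι → ℝ) : 0 ≤ looForm lam k z :=
  mul_nonneg (by positivity) (quadForm_resolvent_nonneg (posSemidef_gram _) hlam _)

theorem measurePreserving_removeNth {d : ℕ} (k : Fin (d + 1)) :
    MeasurePreserving (fun z : Fin (d + 1) → ι → ℝ => (z k, k.removeNth z))
      (colNormal (Fin (d + 1)) ι) ((stdNormal ι).prod (colNormal (Fin d) ι)) :=
  measurePreserving_piFinSuccAbove (fun _ : Fin (d + 1) => stdNormal ι) k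

theorem finiteMoments_looForm {d : ℕ} {lam : ℝ} (hlam : 0 < lam) (k : Fin (d + 1)) :
    FiniteMoments (fun z : Fin (d + 1) → ι → ℝ => looForm lam k z)
      (colNormal (Fin (d + 1)) ι) :=
  ((finiteMoments_quadForm_resolvent hlam).comp (measurePreserving_removeNth k)).const_mul _

/-- Take the normalized trace of Q A = 1 - lam Q, expand A over its columns, and apply
Sherman–Morrison to each column. -/
theorem one_sub_mul_stieltjes [Nonempty ι] {d : ℕ} {lam : ℝ} (hlam : 0 < lam)
    (z : Fin (d + 1) → ι → ℝ) :
    1 - lam * stieltjes lam z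
      = (Fintype.card ι : ℝ)⁻¹ * ∑ k, looForm lam k z / (1 + looForm lam k z) := by
  have hn : (Fintype.card ι : ℝ) ≠ 0 := by simp
  have h := trace_mul_gram (resolvent (gram z) lam) z
  rw [resolvent_mul (posSemidef_gram z) hlam, trace_sub, trace_one, trace_smul, smul_eq_mul,
    Finset.mul_sum] at h
  have h2 : ∀ k, (Fintype.card ι : ℝ)⁻¹ * (z k ⬝ᵥ resolvent (gram z) lam *ᵥ z k)
      = looForm lam k z / (1 + looForm lam k z) := by
    intro k
    rw [gram_succAbove k z]
    exact quadForm_resolvent_rankOne (posSemidef_gram _) hlam (by positivity) (z k)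
  simp only [h2] at h
  rw [← h, stieltjes]
  field_simp

/-- Replacing the trace with column k removed by the full trace costs at most the rank-one
perturbation bound; then (a + b)² ≤ 2a² + 2b². -/
theorem sq_looForm_sub_stieltjes_le [Nonempty ι] {d : ℕ} {lam : ℝ} (hlam : 0 < lam)
    (k : Fin (d + 1)) (z : Fin (d + 1) → ι → ℝ) :
    (looForm lam k z - stieltjes lam z) ^ 2
      ≤ 2 * (looForm lam k z - stieltjes lam (k.removeNth z)) ^ 2
        + 2 * (1 / (lam * Fintype.card ι)) ^ 2 := by
  have hn : (0 : ℝ) < Fintype.card ι := by exact_mod_cast Fintype.card_pos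
  have h : |stieltjes lam (k.removeNth z) - stieltjes lam z| ≤ 1 / (lam * Fintype.card ι) := by
    have := abs_trace_resolvent_rankOne_sub_le (posSemidef_gram (k.removeNth z)) hlam
      (c := (Fintype.card ι : ℝ)⁻¹) (by positivity) (z k)
    rw [← gram_succAbove] at this
    rw [stieltjes, stieltjes, ← sub_div, abs_div, abs_of_pos hn, ← div_div]
    gcongr
  have h2 := sq_le_sq' (neg_le_of_abs_le h) (le_of_abs_le h)
  nlinarith [sq_nonneg ((looForm lam k z - stieltjes lam (k.removeNth z))
    - (stieltjes lam (k.removeNth z) - stieltjes lam z))]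

/-- Column k is independent of the others. With those frozen, the integral is the variance of a
quadratic form, a multiple of tr Q² / n², and tr Q² ≤ n / lam². -/
theorem integral_sq_looForm_sub_le [Nonempty ι] {d : ℕ} {lam : ℝ} (hlam : 0 < lam)
    (k : Fin (d + 1)) :
    ∫ z, (looForm lam k z - stieltjes lam (k.removeNth z)) ^ 2 ∂(colNormal (Fin (d + 1)) ι)
      ≤ |kurt - 1| / (lam ^ 2 * Fintype.card ι) := by
  have hn : (0 : ℝ) < Fintype.card ι := by exact_mod_cast Fintype.card_pos
  set F : (ι → ℝ) × (Fin d → ι → ℝ) → ℝ := fun y =>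
    ((Fintype.card ι : ℝ)⁻¹ * (y.1 ⬝ᵥ resolvent (gram y.2) lam *ᵥ y.1)
      - stieltjes lam y.2) ^ 2 with hF
  have hFm : FiniteMoments F ((stdNormal ι).prod (colNormal (Fin d) ι)) :=
    (((finiteMoments_quadForm_resolvent hlam).const_mul _).sub
      ((finiteMoments_stieltjes hlam).comp measurePreserving_snd)).pow 2
  have h1 : ∫ z, (looForm lam k z - stieltjes lam (k.removeNth z)) ^ 2
        ∂(colNormal (Fin (d + 1)) ι)
      = ∫ y, F y ∂((stdNormal ι).prod (colNormal (Fin d) ι)) := by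
    rw [← (measurePreserving_removeNth k).map_eq, integral_map
      (measurePreserving_removeNth k).measurable.aemeasurable]
    · rfl
    · rw [(measurePreserving_removeNth k).map_eq]
      exact hFm.integrable.aestronglyMeasurable
  rw [h1, integral_prod_symm _ hFm.integrable]
  have h2 : ∀ z' : Fin d → ι → ℝ, ∫ v, F (v, z') ∂(stdNormal ι)
      ≤ |kurt - 1| / (lam ^ 2 * Fintype.card ι) := by
    intro z'
    have hps := posSemidef_resolvent (posSemidef_gram z') hlam
    have e : ∀ v : ι → ℝ, F (v, z') = (Fintype.card ι : ℝ)⁻¹ ^ 2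
        * (v ⬝ᵥ resolvent (gram z') lam *ᵥ v - (resolvent (gram z') lam).trace) ^ 2 := by
      intro v
      simp only [hF, stieltjes]
      ring
    simp only [e]
    rw [integral_const_mul, integral_sq_quadForm_sub_trace _ hps.isHermitian]
    have t0 := trace_sq_resolvent_nonneg (posSemidef_gram z') hlam
    have t1 := trace_sq_resolvent_le (posSemidef_gram z') hlam
    calc _ ≤ (Fintype.card ι : ℝ)⁻¹ ^ 2 * (|kurt - 1| * (Fintype.card ι / lam ^ 2)) := by
          gcongr
          exact le_abs_self _
      _ = _ := by field_simp
  calc _ ≤ ∫ _ : Fin d → ι → ℝ, |kurt - 1| / (lam ^ 2 * Fintype.card ι) ∂(colNormal (Fin d) ι) :=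
        integral_mono hFm.integrable.integral_prod_right (integrable_const _) h2
    _ = _ := by simp

theorem sq_div_one_add_sub_le {a b : ℝ} (ha : 0 ≤ a) (hb : 0 ≤ b) :
    (a / (1 + a) - b / (1 + b)) ^ 2 ≤ (a - b) ^ 2 := by
  have : a / (1 + a) - b / (1 + b) = (a - b) / ((1 + a) * (1 + b)) := by
    field_simp; ring
  rw [this, div_pow]
  refine div_le_self (sq_nonneg _) (one_le_pow₀ ?_)
  nlinarith [mul_nonneg ha hb]

/-- The squared defect in the Marchenko–Pastur fixed-point equation is controlled by the
fluctuations of the leave-one-out quadratic forms. -/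
theorem sq_defect_le [Nonempty ι] {d : ℕ} {lam : ℝ} (hlam : 0 < lam)
    (z : Fin (d + 1) → ι → ℝ) :
    (1 - lam * stieltjes lam z - ((d + 1 : ℕ) : ℝ) / Fintype.card ι
        * (stieltjes lam z / (1 + stieltjes lam z))) ^ 2
      ≤ (Fintype.card ι : ℝ)⁻¹ ^ 2 * (((d + 1 : ℕ) : ℝ)
        * ∑ k, (looForm lam k z - stieltjes lam z) ^ 2) := by
  set s := stieltjes lam z with hs
  have e : 1 - lam * s - ((d + 1 : ℕ) : ℝ) / Fintype.card ι * (s / (1 + s))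
      = (Fintype.card ι : ℝ)⁻¹ * ∑ k, (looForm lam k z / (1 + looForm lam k z) - s / (1 + s)) := by
    rw [hs, one_sub_mul_stieltjes hlam z, Finset.sum_sub_distrib, Finset.sum_const,
      Finset.card_univ, Fintype.card_fin, nsmul_eq_mul]
    ring
  rw [e, mul_pow]
  refine mul_le_mul_of_nonneg_left ?_ (sq_nonneg _)
  have h := sq_sum_le_card_mul_sum_sq (s := Finset.univ)
    (f := fun k => looForm lam k z / (1 + looForm lam k z) - s / (1 + s))
  rw [Finset.card_univ, Fintype.card_fin] at h
  refine h.trans (mul_le_mul_of_nonneg_left (Finset.sum_le_sum fun k _ => ?_) (Nat.cast_nonneg _))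
  exact sq_div_one_add_sub_le (looForm_nonneg hlam k z) (stieltjes_nonneg hlam z)

/-- Stability of the fixed-point equation: on s ≥ 0 its left side decreases with slope at least
`lam` in absolute value, so the defect bounds the distance to the root. Replacing ζ by the finite
ratio r costs at most |r - ζ|, because s/(1+s) ≤ 1. -/
theorem sq_sub_le_of_fixedPoint {lam ζ r s m : ℝ} (hlam : 0 < lam) (hζ : 0 ≤ ζ) (hs : 0 ≤ s)
    (hm : 0 ≤ m) (hfix : 1 - lam * m - ζ * (m / (1 + m)) = 0) :
    lam ^ 2 * (s - m) ^ 2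
      ≤ 2 * (1 - lam * s - r * (s / (1 + s))) ^ 2 + 2 * (r - ζ) ^ 2 := by
  have h1 : 1 - lam * s - ζ * (s / (1 + s)) = -(lam + ζ / ((1 + s) * (1 + m))) * (s - m) := by
    rw [← sub_zero (1 - lam * s - ζ * (s / (1 + s))), ← hfix]
    field_simp
    ring
  have h2 : lam ^ 2 * (s - m) ^ 2 ≤ (1 - lam * s - ζ * (s / (1 + s))) ^ 2 := by
    rw [h1, mul_pow, neg_sq]
    have : 0 ≤ ζ / ((1 + s) * (1 + m)) := by positivity
    gcongr
    linarith
  have h3 : (s / (1 + s)) ^ 2 ≤ 1 := by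
    rw [div_pow, div_le_one (by positivity)]
    nlinarith
  have h4 : (r - ζ) ^ 2 * (s / (1 + s)) ^ 2 ≤ (r - ζ) ^ 2 :=
    mul_le_of_le_one_right (sq_nonneg _) h3
  nlinarith [sq_nonneg ((1 - lam * s - r * (s / (1 + s))) - (r - ζ) * (s / (1 + s)))]

/-- Quantitative Marchenko–Pastur theorem for the normalized trace of the resolvent. -/
theorem integral_sq_stieltjes_sub_le [Nonempty ι] {d : ℕ} (hd : d ≠ 0) {lam ζ m : ℝ}
    (hlam : 0 < lam) (hζ : 0 ≤ ζ) (hm : 0 ≤ m) (hfix : 1 - lam * m - ζ * (m / (1 + m)) = 0) :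
    lam ^ 2 * ∫ z, (stieltjes lam z - m) ^ 2 ∂(colNormal (Fin d) ι)
      ≤ 2 * ((d : ℝ) / Fintype.card ι) ^ 2
          * (2 * (|kurt - 1| / (lam ^ 2 * Fintype.card ι))
            + 2 * (1 / (lam * Fintype.card ι)) ^ 2)
        + 2 * ((d : ℝ) / Fintype.card ι - ζ) ^ 2 := by
  -- The leave-one-out lemmas need at least one column to remove.
  obtain ⟨d, rfl⟩ := Nat.exists_eq_succ_of_ne_zero hd
  rw [Nat.succ_eq_add_one]
  set n : ℝ := (Fintype.card ι : ℝ)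
  set B : ℝ := 2 * (|kurt - 1| / (lam ^ 2 * n)) + 2 * (1 / (lam * n)) ^ 2
  set r : ℝ := ((d + 1 : ℕ) : ℝ) / n with hr
  have hst := finiteMoments_stieltjes (κ := Fin (d + 1)) (ι := ι) hlam
  have hq : ∀ k : Fin (d + 1), ∫ z, (looForm lam k z - stieltjes lam z) ^ 2
      ∂(colNormal (Fin (d + 1)) ι) ≤ B := by
    intro k
    have hi : Integrable (fun z => (looForm lam k z - stieltjes lam (k.removeNth z)) ^ 2)
        (colNormal (Fin (d + 1)) ι) := (((finiteMoments_looForm hlam k).sub ((finiteMoments_stieltjes hlam).comp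
      (measurePreserving_snd.comp (measurePreserving_removeNth (ι := ι) k)))).pow 2).integrable
    calc _ ≤ ∫ z, (2 * (looForm lam k z - stieltjes lam (k.removeNth z)) ^ 2
          + 2 * (1 / (lam * n)) ^ 2) ∂(colNormal (Fin (d + 1)) ι) :=
          integral_mono (((finiteMoments_looForm hlam k).sub hst).pow 2).integrable
            ((hi.const_mul 2).add (integrable_const _)) (sq_looForm_sub_stieltjes_le hlam k)
      _ = 2 * (∫ z, (looForm lam k z - stieltjes lam (k.removeNth z)) ^ 2
            ∂(colNormal (Fin (d + 1)) ι)) + 2 * (1 / (lam * n)) ^ 2 := by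
          rw [integral_add (hi.const_mul 2) (integrable_const _), integral_const_mul]
          simp
      _ ≤ _ := by
          have := integral_sq_looForm_sub_le (ι := ι) hlam k
          linarith
  have hpt : ∀ z : Fin (d + 1) → ι → ℝ, lam ^ 2 * (stieltjes lam z - m) ^ 2
      ≤ 2 * (n⁻¹ ^ 2 * (((d + 1 : ℕ) : ℝ) * ∑ k, (looForm lam k z - stieltjes lam z) ^ 2))
        + 2 * (r - ζ) ^ 2 := fun z =>
    (sq_sub_le_of_fixedPoint (r := r) hlam hζ (stieltjes_nonneg hlam z) hm hfix).trans
      (by have := sq_defect_le hlam z; gcongr)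
  have hsum : Integrable (fun z => ∑ k, (looForm lam k z - stieltjes lam z) ^ 2)
      (colNormal (Fin (d + 1)) ι) :=
    (FiniteMoments.sum _ fun k => ((finiteMoments_looForm hlam k).sub hst).pow 2).integrable
  rw [← integral_const_mul]
  calc _ ≤ ∫ z, (2 * (n⁻¹ ^ 2 * (((d + 1 : ℕ) : ℝ)
          * ∑ k, (looForm lam k z - stieltjes lam z) ^ 2)) + 2 * (r - ζ) ^ 2)
          ∂(colNormal (Fin (d + 1)) ι) :=
        integral_mono (((hst.sub (.const m)).pow 2).const_mul _).integrable
          ((((hsum.const_mul _).const_mul _).const_mul _).add (integrable_const _)) hpt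
    _ = 2 * (n⁻¹ ^ 2 * (((d + 1 : ℕ) : ℝ) * ∑ k, ∫ z, (looForm lam k z - stieltjes lam z) ^ 2
          ∂(colNormal (Fin (d + 1)) ι))) + 2 * (r - ζ) ^ 2 := by
        rw [integral_add (((hsum.const_mul _).const_mul _).const_mul _) (integrable_const _),
          integral_const_mul, integral_const_mul, integral_const_mul,
          integral_finsetSum _ fun k _ => (((finiteMoments_looForm hlam k).sub hst).pow 2).integrable]
        simp
    _ ≤ 2 * (n⁻¹ ^ 2 * (((d + 1 : ℕ) : ℝ) * ∑ _k : Fin (d + 1), B)) + 2 * (r - ζ) ^ 2 := by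
        gcongr with k _
        exact hq k
    _ = _ := by
        rw [Finset.sum_const, Finset.card_univ, Fintype.card_fin, nsmul_eq_mul, hr]
        ring

end Gram

/-! ### Resolvent moments of the Marchenko–Pastur law -/

section MarchenkoPastur

open Set

/-! ### Elementary integrals of the semicircle-type density -/

theorem hasDerivAt_sqrt_quadratic {a b x : ℝ} (hx : x ∈ Ioo a b) :
    HasDerivAt (fun x => √((b - x) * (x - a)))
      (((a + b) / 2 - x) / √((b - x) * (x - a))) x := by
  have hpos : 0 < (b - x) * (x - a) := mul_pos (by linarith [hx.2]) (by linarith [hx.1])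
  have h1 : HasDerivAt (fun x => (b - x) * (x - a)) (-1 * (x - a) + (b - x) * 1) x :=
    ((hasDerivAt_id x).const_sub b).mul ((hasDerivAt_id x).sub_const a)
  refine (h1.sqrt hpos.ne').congr_deriv ?_
  have := (Real.sqrt_pos.2 hpos).ne'
  field_simp
  ring

theorem hasDerivAt_arcsin_affine {a b x : ℝ} (hx : x ∈ Ioo a b) :
    HasDerivAt (fun x => Real.arcsin ((2 * x - a - b) / (b - a)))
      (1 / √((b - x) * (x - a))) x := by
  have hab : 0 < b - a := by linarith [hx.1, hx.2]
  have hpos : 0 < (b - x) * (x - a) := mul_pos (by linarith [hx.2]) (by linarith [hx.1])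
  have h1 : HasDerivAt (fun x => (2 * x - a - b) / (b - a)) (2 / (b - a)) x := by
    have := ((((hasDerivAt_id x).const_mul 2).sub_const a).sub_const b).div_const (b - a)
    simpa using this
  have h2 : (2 * x - a - b) / (b - a) ≠ -1 := by
    rw [Ne, div_eq_iff hab.ne']; intro h; linarith [hx.1]
  have h3 : (2 * x - a - b) / (b - a) ≠ 1 := by
    rw [Ne, div_eq_iff hab.ne']; intro h; linarith [hx.2]
  refine ((Real.hasDerivAt_arcsin h2 h3).comp x h1).congr_deriv ?_
  have e : 1 - ((2 * x - a - b) / (b - a)) ^ 2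
      = ((b - x) * (x - a)) * (2 / (b - a)) ^ 2 := by
    field_simp; ring
  rw [e, Real.sqrt_mul hpos.le, Real.sqrt_sq (by positivity)]
  have := (Real.sqrt_pos.2 hpos).ne'
  field_simp

theorem hasDerivAt_arcsin_inv {a b x : ℝ} (ha : 0 < a) (hx : x ∈ Ioo a b) :
    HasDerivAt (fun x => Real.arcsin ((a + b - 2 * (a * b) / x) / (b - a)))
      (√(a * b) / (x * √((b - x) * (x - a)))) x := by
  have hab : 0 < b - a := by linarith [hx.1, hx.2]
  have hx0 : 0 < x := ha.trans hx.1
  have hb : 0 < b := hx0.trans hx.2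
  have hpos : 0 < (b - x) * (x - a) := mul_pos (by linarith [hx.2]) (by linarith [hx.1])
  have h1 : HasDerivAt (fun x => (a + b - 2 * (a * b) / x) / (b - a))
      (2 * (a * b) / x ^ 2 / (b - a)) x := by
    have := (((hasDerivAt_inv hx0.ne').const_mul (2 * (a * b))).const_sub (a + b)).div_const (b - a)
    simp only [← div_eq_mul_inv] at this
    refine this.congr_deriv ?_
    field_simp
  have h2 : (a + b - 2 * (a * b) / x) / (b - a) ≠ -1 := by
    rw [Ne, div_eq_iff hab.ne']; intro h
    field_simp at h
    nlinarith [mul_pos hb (sub_pos.2 hx.1)]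
  have h3 : (a + b - 2 * (a * b) / x) / (b - a) ≠ 1 := by
    rw [Ne, div_eq_iff hab.ne']; intro h
    field_simp at h
    nlinarith [mul_pos ha (sub_pos.2 hx.2)]
  refine ((Real.hasDerivAt_arcsin h2 h3).comp x h1).congr_deriv ?_
  have e : 1 - ((a + b - 2 * (a * b) / x) / (b - a)) ^ 2
      = ((b - x) * (x - a)) * (a * b) * (2 / (x * (b - a))) ^ 2 := by
    field_simp; ring
  rw [e, Real.sqrt_mul (by positivity), Real.sqrt_mul hpos.le, Real.sqrt_sq (by positivity)]
  have h4 := (Real.sqrt_pos.2 hpos).ne'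
  have h5 := (Real.sqrt_pos.2 (mul_pos ha hb)).ne'
  have h6 := Real.mul_self_sqrt (mul_pos ha hb).le
  field_simp
  rw [sq, mul_comm b a, h6]

/-- F is an explicit antiderivative, continuous up to the endpoints, where both arcsines equal ±π/2.
The case a = 0 must be covered, since it is the left edge at ζ = 1; there the coefficient √(ab)
removes the second arcsine. -/
theorem integral_sqrt_quadratic_div {a b : ℝ} (ha : 0 ≤ a) (hab : a < b) :
    IntervalIntegrable (fun x => √((b - x) * (x - a)) / x) volume a b ∧
    ∫ x in a..b, √((b - x) * (x - a)) / x = Real.pi * ((a + b) / 2 - √(a * b)) := by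
  have hba : b - a ≠ 0 := by linarith
  set F : ℝ → ℝ := fun x => √((b - x) * (x - a))
    + (a + b) / 2 * Real.arcsin ((2 * x - a - b) / (b - a))
    - √(a * b) * Real.arcsin ((a + b - 2 * (a * b) / x) / (b - a)) with hF
  have hcont : ContinuousOn F (Icc a b) := by
    refine ContinuousOn.sub (Continuous.continuousOn (by fun_prop)) ?_
    rcases ha.eq_or_lt with rfl | ha'
    · simp only [zero_mul, Real.sqrt_zero]
      exact continuousOn_const
    · refine continuousOn_const.mul (Real.continuous_arcsin.comp_continuousOn ?_)
      refine ContinuousOn.div_const (continuousOn_const.sub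
        (continuousOn_const.div continuousOn_id fun x hx => ?_)) _
      exact (ha'.trans_le hx.1).ne'
  have hderiv : ∀ x ∈ Ioo a b, HasDerivAt F (√((b - x) * (x - a)) / x) x := by
    intro x hx
    have hx0 : 0 < x := ha.trans_lt hx.1
    have hpos : 0 < (b - x) * (x - a) := mul_pos (by linarith [hx.2]) (by linarith [hx.1])
    have h4 := (Real.sqrt_pos.2 hpos).ne'
    have h5 := Real.sq_sqrt hpos.le
    have h3 : HasDerivAt (fun x => √(a * b) * Real.arcsin ((a + b - 2 * (a * b) / x) / (b - a)))
        (a * b / (x * √((b - x) * (x - a)))) x := by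
      rcases ha.eq_or_lt with rfl | ha'
      · simp only [zero_mul, Real.sqrt_zero, zero_div]
        exact hasDerivAt_const _ _
      · refine ((hasDerivAt_arcsin_inv ha' hx).const_mul (√(a * b))).congr_deriv ?_
        rw [← mul_div_assoc, Real.mul_self_sqrt (mul_pos ha' (ha'.trans hab)).le]
    refine (((hasDerivAt_sqrt_quadratic hx).add
      ((hasDerivAt_arcsin_affine hx).const_mul ((a + b) / 2))).sub h3).congr_deriv ?_
    field_simp
    rw [h5]
    ring
  -- For a = 0 the integrand is unbounded near 0; being nonnegative and the derivative of a function
  -- continuous on [a, b], it is integrable.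
  have hint : IntervalIntegrable (fun x => √((b - x) * (x - a)) / x) volume a b := by
    rw [intervalIntegrable_iff_integrableOn_Ioc_of_le hab.le]
    exact intervalIntegral.integrableOn_deriv_of_nonneg hcont hderiv fun x hx =>
      div_nonneg (Real.sqrt_nonneg _) (ha.trans hx.1.le)
  refine ⟨hint, ?_⟩
  rw [intervalIntegral.integral_eq_sub_of_hasDerivAt_of_le hab.le hcont hderiv hint]
  have hb : 0 < b := ha.trans_lt hab
  have e1 : (2 * b - a - b) / (b - a) = 1 := by field_simp; ring
  have e2 : (2 * a - a - b) / (b - a) = -1 := by field_simp; ring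
  have e3 : (a + b - 2 * (a * b) / b) / (b - a) = 1 := by field_simp; ring
  simp only [hF, e1, e2, e3, sub_self, zero_mul, mul_zero, Real.sqrt_zero, Real.arcsin_one,
    Real.arcsin_neg_one]
  rcases ha.eq_or_lt with rfl | ha'
  · simp
    ring
  · have e4 : (a + b - 2 * (a * b) / a) / (b - a) = -1 := by field_simp; ring
    rw [e4, Real.arcsin_neg_one]
    ring

theorem integral_sqrt_quadratic_div_add {a b c : ℝ} (ha : 0 ≤ a + c) (hab : a < b) :
    IntervalIntegrable (fun x => √((b - x) * (x - a)) / (x + c)) volume a b ∧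
    ∫ x in a..b, √((b - x) * (x - a)) / (x + c)
      = Real.pi * ((a + b) / 2 + c - √((a + c) * (b + c))) := by
  have h := integral_sqrt_quadratic_div ha (show a + c < b + c by linarith)
  have e : ∀ x : ℝ, √((b + c - (x + c)) * (x + c - (a + c))) / (x + c)
      = √((b - x) * (x - a)) / (x + c) := fun x => by congr 3 <;> ring
  constructor
  · have := h.1.comp_add_right c
    simp only [e, add_sub_cancel_right] at this
    exact this
  · have h2 := intervalIntegral.integral_comp_add_right
      (fun x => √((b + c - x) * (x - (a + c))) / x) c (a := a) (b := b)
    simp only [e] at h2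
    rw [h2, h.2]
    ring

/-- The Stieltjes transform at `-lam` of the companion Marchenko–Pastur law. -/
noncomputable def mpRoot (ζ lam : ℝ) : ℝ :=
  ((1 - ζ - lam) + √((1 - ζ - lam) ^ 2 + 4 * lam)) / (2 * lam)

theorem mpRoot_pos {ζ lam : ℝ} (hlam : 0 < lam) : 0 < mpRoot ζ lam := by
  refine div_pos ?_ (by positivity)
  have : |1 - ζ - lam| < √((1 - ζ - lam) ^ 2 + 4 * lam) := by
    rw [← Real.sqrt_sq_eq_abs]
    exact Real.sqrt_lt_sqrt (sq_nonneg _) (by linarith)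
  linarith [neg_abs_le (1 - ζ - lam)]

/-- Clearing denominators gives lam m² - (1 - ζ - lam) m - 1 = 0, of which `mpRoot` is the root with
the positive sign. -/
theorem mpRoot_fixedPoint {ζ lam : ℝ} (hlam : 0 < lam) :
    1 - lam * mpRoot ζ lam - ζ * (mpRoot ζ lam / (1 + mpRoot ζ lam)) = 0 := by
  have hm := mpRoot_pos (ζ := ζ) hlam
  have h : 2 * lam * mpRoot ζ lam - (1 - ζ - lam) = √((1 - ζ - lam) ^ 2 + 4 * lam) := by
    rw [mpRoot]; field_simp; ring
  have h2 : (2 * lam * mpRoot ζ lam - (1 - ζ - lam)) ^ 2 = (1 - ζ - lam) ^ 2 + 4 * lam := by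
    rw [h, Real.sq_sqrt (by positivity)]
  field_simp
  have h3 : 4 * lam * (lam * mpRoot ζ lam ^ 2 - (1 - ζ - lam) * mpRoot ζ lam - 1) = 0 := by
    linear_combination h2
  have h4 := (mul_eq_zero.1 h3).resolve_left (by positivity)
  linear_combination -h4

/-! ### Integration against the Marchenko–Pastur law -/

theorem mpLeft_lt_mpRight {ζ : ℝ} (hζ : 0 < ζ) : mpLeft ζ < mpRight ζ := by
  have := Real.sqrt_pos.2 hζ
  simp only [mpLeft, mpRight]; nlinarith

theorem mpLeft_nonneg (ζ : ℝ) : 0 ≤ mpLeft ζ := sq_nonneg _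

theorem mpDensity_nonneg {ζ : ℝ} (hζ : 0 < ζ) (x : ℝ) : 0 ≤ mpDensity ζ x := by
  refine indicator_nonneg (fun x hx => ?_) x
  have : 0 ≤ x := (mpLeft_nonneg ζ).trans hx.1
  positivity

theorem measurable_mpDensity (ζ : ℝ) : Measurable (mpDensity ζ) :=
  Measurable.indicator (by fun_prop) measurableSet_Icc

theorem integral_mpDensity_mul {ζ : ℝ} (hζ : 0 < ζ) (g : ℝ → ℝ) :
    ∫ x, mpDensity ζ x * g x = ∫ x in mpLeft ζ..mpRight ζ,
      √((mpRight ζ - x) * (x - mpLeft ζ)) / (2 * Real.pi * ζ * x) * g x := by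
  have e : ∀ x, mpDensity ζ x * g x = (Icc (mpLeft ζ) (mpRight ζ)).indicator (fun x =>
      √((mpRight ζ - x) * (x - mpLeft ζ)) / (2 * Real.pi * ζ * x) * g x) x := fun x => by
    rw [mpDensity, indicator_mul_left]
  simp only [e]
  rw [integral_indicator measurableSet_Icc, integral_Icc_eq_integral_Ioc,
    intervalIntegral.integral_of_le (mpLeft_lt_mpRight hζ).le]

theorem integrable_mpDensity {ζ : ℝ} (hζ : 0 < ζ) : Integrable (mpDensity ζ) := by
  have h := (integral_sqrt_quadratic_div (mpLeft_nonneg ζ) (mpLeft_lt_mpRight hζ)).1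
  rw [intervalIntegrable_iff_integrableOn_Icc_of_le (mpLeft_lt_mpRight hζ).le] at h
  unfold mpDensity
  rw [integrable_indicator_iff measurableSet_Icc]
  refine (h.const_mul (1 / (2 * Real.pi * ζ))).congr (ae_of_all _ fun x => ?_)
  simp only [div_eq_mul_inv, mul_inv]
  ring

theorem isFiniteMeasure_marchenkoPastur {ζ : ℝ} (hζ : 0 < ζ) :
    IsFiniteMeasure (marchenkoPastur ζ) := by
  have h1 : IsFiniteMeasure (volume.withDensity (fun x => ENNReal.ofReal (mpDensity ζ x))) :=
    isFiniteMeasure_withDensity_ofReal (integrable_mpDensity hζ).2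
  have h2 : IsFiniteMeasure (ENNReal.ofReal (1 - 1 / ζ) • Measure.dirac (0 : ℝ)) :=
    Measure.smul_finite _ (by simp)
  unfold marchenkoPastur
  infer_instance

theorem ae_nonneg_marchenkoPastur (ζ : ℝ) : ∀ᵐ x ∂(marchenkoPastur ζ), 0 ≤ x := by
  rw [marchenkoPastur, ae_add_measure_iff]
  constructor
  · exact Measure.ae_smul_measure (by simp [ae_dirac_eq]) _
  · rw [ae_withDensity_iff (by exact (measurable_mpDensity ζ).ennreal_ofReal)]
    refine ae_of_all _ fun x hx => ?_
    by_contra hneg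
    refine hx ?_
    rw [mpDensity, indicator_of_notMem, ENNReal.ofReal_zero]
    exact fun h => hneg ((mpLeft_nonneg ζ).trans h.1)

theorem integrable_inv_pow_marchenkoPastur {ζ lam : ℝ} (hζ : 0 < ζ) (hlam : 0 < lam) (i : ℕ) :
    Integrable (fun x => ((x + lam) ^ i)⁻¹) (marchenkoPastur ζ) := by
  have := isFiniteMeasure_marchenkoPastur hζ
  refine Integrable.of_bound (by fun_prop) ((lam ^ i)⁻¹) ?_
  filter_upwards [ae_nonneg_marchenkoPastur ζ] with x hx
  rw [Real.norm_of_nonneg (by positivity)]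
  gcongr
  linarith

/-- The first summand is the atom. For the density, the partial fractions 1/(x(x + lam)) = (1/x -
1/(x + lam))/lam leave two integrals already known. With edges a and b, ab = (1 - ζ)² and (a +
lam)(b + lam) is the discriminant in `mpRoot`. -/
theorem theta_one_eq {ζ lam : ℝ} (hζ : 0 < ζ) (hlam : 0 < lam) :
    theta 1 ζ lam = max (1 - 1 / ζ) 0 / lam
      + (√((1 - ζ - lam) ^ 2 + 4 * lam) - lam - |1 - ζ|) / (2 * ζ * lam) := by
  have hint := integrable_inv_pow_marchenkoPastur hζ hlam 1
  have hs := Real.sq_sqrt hζ.le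
  rw [theta, marchenkoPastur, integral_add_measure]
  rotate_left
  · exact hint.mono_measure (Measure.le_add_right le_rfl)
  · exact hint.mono_measure (Measure.le_add_left le_rfl)
  congr 1
  · rw [integral_smul_measure, integral_dirac, ENNReal.toReal_ofReal']
    simp [div_eq_mul_inv]
  · rw [integral_withDensity_eq_integral_toReal_smul
      (measurable_mpDensity ζ).ennreal_ofReal (by simp)]
    simp only [ENNReal.toReal_ofReal (mpDensity_nonneg hζ _), smul_eq_mul]
    rw [integral_mpDensity_mul hζ]
    have hab := mpLeft_lt_mpRight hζ
    have ha := mpLeft_nonneg ζ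
    obtain ⟨i1, e1⟩ := integral_sqrt_quadratic_div ha hab
    obtain ⟨i2, e2⟩ := integral_sqrt_quadratic_div_add (c := lam) (by linarith) hab
    have h1 : ∫ x in mpLeft ζ..mpRight ζ,
        √((mpRight ζ - x) * (x - mpLeft ζ)) / (2 * Real.pi * ζ * x) * ((x + lam) ^ 1)⁻¹
        = ∫ x in mpLeft ζ..mpRight ζ, 1 / (2 * Real.pi * ζ * lam)
          * (√((mpRight ζ - x) * (x - mpLeft ζ)) / x
            - √((mpRight ζ - x) * (x - mpLeft ζ)) / (x + lam)) := by
      rw [intervalIntegral.integral_of_le hab.le, intervalIntegral.integral_of_le hab.le]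
      refine setIntegral_congr_fun measurableSet_Ioc fun x hx => ?_
      have hx0 : 0 < x := ha.trans_lt hx.1
      have : x + lam ≠ 0 := by positivity
      have := Real.pi_ne_zero
      simp only [pow_one]
      field_simp
      ring
    rw [h1, intervalIntegral.integral_const_mul, intervalIntegral.integral_sub i1 i2, e1, e2]
    have e3 : mpLeft ζ * mpRight ζ = (1 - ζ) ^ 2 := by
      simp only [mpLeft, mpRight]
      linear_combination (√ζ ^ 2 + ζ - 2) * hs
    have e4 : mpLeft ζ + mpRight ζ = 2 * (1 + ζ) := by
      simp only [mpLeft, mpRight]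
      linear_combination 2 * hs
    have e5 : (mpLeft ζ + lam) * (mpRight ζ + lam) = (1 - ζ - lam) ^ 2 + 4 * lam := by
      linear_combination e3 + lam * e4
    rw [e3, e4, e5, Real.sqrt_sq_eq_abs]
    have := Real.pi_ne_zero
    field_simp
    ring

/-- The atom contributes max (ζ - 1) 0 = (ζ - 1 + |1 - ζ|)/2, which cancels the |1 - ζ| from the
density, so one formula serves ζ below and above 1. -/
theorem thetaBar_one_eq {ζ lam : ℝ} (hζ : 0 < ζ) (hlam : 0 < lam) :
    thetaBar 1 ζ lam = mpRoot ζ lam := by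
  have h : ζ * max (1 - 1 / ζ) 0 = max (ζ - 1) 0 := by
    rw [mul_max_of_nonneg _ _ hζ.le]
    congr 1 <;> field_simp
    simp
  have h2 : max (ζ - 1) 0 = (ζ - 1 + |1 - ζ|) / 2 := by
    rw [abs_sub_comm]
    rcases le_total (ζ - 1) 0 with h | h
    · rw [max_eq_right h, abs_of_nonpos h]; ring
    · rw [max_eq_left h, abs_of_nonneg h]; ring
  rw [thetaBar, theta_one_eq hζ hlam, mpRoot, mul_add, ← mul_div_assoc, h, h2]
  field_simp
  ring

theorem abs_inv_sub_inv_sub_le {x lam mu : ℝ} (hx : 0 ≤ x) (hlam : 0 < lam) (hmu : 0 < mu) :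
    |((x + lam) ^ 1)⁻¹ - ((x + mu) ^ 1)⁻¹ - (mu - lam) * ((x + lam) ^ 2)⁻¹|
      ≤ (mu - lam) ^ 2 / (lam ^ 2 * mu) := by
  have e : ((x + lam) ^ 1)⁻¹ - ((x + mu) ^ 1)⁻¹ - (mu - lam) * ((x + lam) ^ 2)⁻¹
      = -((mu - lam) ^ 2 / ((x + lam) ^ 2 * (x + mu))) := by
    have : x + lam ≠ 0 := by positivity
    have : x + mu ≠ 0 := by positivity
    field_simp
    ring
  rw [e, abs_neg, abs_of_nonneg (by positivity)]
  gcongr <;> linarith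

/-- Scalar counterpart of `trace_resolvent_sub`, integrated over the law. Only finiteness of its
mass V enters, and `lam < mu` makes the constant independent of `mu`. -/
theorem exists_thetaBar_sub_le {ζ lam : ℝ} (hζ : 0 < ζ) (hlam : 0 < lam) :
    ∃ C, 0 ≤ C ∧ ∀ mu, lam < mu →
      |thetaBar 1 ζ lam - thetaBar 1 ζ mu - (mu - lam) * thetaBar 2 ζ lam|
        ≤ (mu - lam) ^ 2 * C := by
  have := isFiniteMeasure_marchenkoPastur hζ
  set V := (marchenkoPastur ζ).real Set.univ
  refine ⟨(|1 - ζ| + ζ * V) / (lam ^ 2 * lam), by positivity, fun mu hmu => ?_⟩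
  have hmu0 : 0 < mu := hlam.trans hmu
  have h1 : |theta 1 ζ lam - theta 1 ζ mu - (mu - lam) * theta 2 ζ lam|
      ≤ (mu - lam) ^ 2 / (lam ^ 2 * mu) * V := by
    have i1 := integrable_inv_pow_marchenkoPastur hζ hlam 1
    have i2 := integrable_inv_pow_marchenkoPastur hζ hmu0 1
    have i3 := integrable_inv_pow_marchenkoPastur hζ hlam 2
    have i4 : Integrable (fun x => ((x + lam) ^ 1)⁻¹ - ((x + mu) ^ 1)⁻¹) (marchenkoPastur ζ) :=
      i1.sub i2
    rw [theta, theta, theta, ← integral_const_mul, ← integral_sub i1 i2,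
      ← integral_sub i4 (i3.const_mul _), ← Real.norm_eq_abs]
    refine norm_integral_le_of_norm_le_const ?_
    filter_upwards [ae_nonneg_marchenkoPastur ζ] with x hx
    exact abs_inv_sub_inv_sub_le hx hlam hmu0
  have h2 := abs_inv_sub_inv_sub_le le_rfl hlam hmu0
  simp only [zero_add] at h2
  have e : thetaBar 1 ζ lam - thetaBar 1 ζ mu - (mu - lam) * thetaBar 2 ζ lam
      = (1 - ζ) * ((lam ^ 1)⁻¹ - (mu ^ 1)⁻¹ - (mu - lam) * (lam ^ 2)⁻¹)
        + ζ * (theta 1 ζ lam - theta 1 ζ mu - (mu - lam) * theta 2 ζ lam) := by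
    simp only [thetaBar, div_eq_mul_inv]; ring
  rw [e]
  calc _ ≤ |1 - ζ| * ((mu - lam) ^ 2 / (lam ^ 2 * mu))
        + ζ * ((mu - lam) ^ 2 / (lam ^ 2 * mu) * V) := by
        refine (abs_add_le _ _).trans ?_
        rw [abs_mul, abs_mul, abs_of_pos hζ]
        gcongr
    _ = (mu - lam) ^ 2 * ((|1 - ζ| + ζ * V) / (lam ^ 2 * mu)) := by ring
    _ ≤ _ := by gcongr

/-- Pointwise convergence passes to slopes under uniform second-order control. -/
theorem tendsto_of_slope_bound {f : ℕ → ℝ → ℝ} {h : ℕ → ℝ} {g : ℝ → ℝ} {g' lam C C' : ℝ}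
    (hC : 0 ≤ C) (hC' : 0 ≤ C')
    (hf : ∀ᶠ k in atTop, ∀ mu, lam < mu →
      |f k lam - f k mu - (mu - lam) * h k| ≤ (mu - lam) ^ 2 * C)
    (hg : ∀ mu, lam < mu → |g lam - g mu - (mu - lam) * g'| ≤ (mu - lam) ^ 2 * C')
    (hlim : ∀ mu, lam ≤ mu → Tendsto (fun k => f k mu) atTop (𝓝 (g mu))) :
    Tendsto h atTop (𝓝 g') := by
  rw [Metric.tendsto_atTop']
  intro ε hε
  set δ := ε / (2 * (C + C' + 1)) with hδ
  have hδ0 : 0 < δ := by positivity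
  have hmu : lam < lam + δ := by linarith
  have hlim2 := ((hlim lam le_rfl).sub (hlim (lam + δ) hmu.le))
  rw [Metric.tendsto_atTop'] at hlim2
  obtain ⟨N, hN⟩ := hlim2 (δ * (ε / 2)) (by positivity)
  obtain ⟨N', hN'⟩ := eventually_atTop.1 hf
  refine ⟨max N N', fun k hk => ?_⟩
  have h1 := hN k (lt_of_le_of_lt (le_max_left _ _) hk)
  have h2 := hN' k ((le_max_right _ _).trans hk.le) _ hmu
  have h3 := hg _ hmu
  rw [Real.dist_eq] at h1 ⊢
  simp only [add_sub_cancel_left] at h2 h3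
  have h4 : δ * |h k - g'| < δ * ε := by
    rw [← abs_of_pos hδ0, ← abs_mul, abs_of_pos hδ0]
    have e : δ * (h k - g') = -(f k lam - f k (lam + δ) - δ * h k)
        + (g lam - g (lam + δ) - δ * g') + (f k lam - f k (lam + δ) - (g lam - g (lam + δ))) := by
      ring
    rw [e]
    have h5 : δ ^ 2 * C + δ ^ 2 * C' ≤ δ * (ε / 2) := by
      have : δ * (C + C' + 1) = ε / 2 := by rw [hδ]; field_simp
      nlinarith [mul_pos hδ0 hδ0]
    calc _ ≤ |f k lam - f k (lam + δ) - δ * h k| + |g lam - g (lam + δ) - δ * g'|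
          + |f k lam - f k (lam + δ) - (g lam - g (lam + δ))| := by
          refine (abs_add_le _ _).trans ?_
          gcongr
          refine (abs_add_le _ _).trans ?_
          rw [abs_neg]
      _ < δ ^ 2 * C + δ ^ 2 * C' + δ * (ε / 2) := by linarith
      _ ≤ _ := by linarith
  exact lt_of_mul_lt_mul_left h4 hδ0.le

end MarchenkoPastur

/-! ### Transformations of Gaussian matrices -/

section GaussianMatrix

set_option linter.unusedSectionVars false

variable {ι κ κ' : Type*} [Fintype ι] [Fintype κ] [Fintype κ']

theorem measurePreserving_curry_stdNormal :
    MeasurePreserving (MeasurableEquiv.curry κ ι ℝ) (stdNormal (κ × ι)) (colNormal κ ι) := by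
  refine MeasurePreserving.symm (MeasurableEquiv.curry κ ι ℝ).symm ⟨MeasurableEquiv.measurable _, ?_⟩
  refine (Measure.pi_eq fun s hs => ?_).symm
  rw [MeasurableEquiv.map_apply]
  have : (MeasurableEquiv.curry κ ι ℝ).symm ⁻¹' Set.univ.pi s
      = Set.univ.pi fun k => Set.univ.pi fun i => s (k, i) := by
    ext z
    simp [Function.uncurry]
  rw [this, colNormal, Measure.pi_pi, Fintype.prod_prod_type]
  simp only [stdNormal, Measure.pi_pi]

theorem measurePreserving_sum_colNormal :
    MeasurePreserving (fun z : κ ⊕ κ' → ι → ℝ => (fun k => z (.inl k), fun k => z (.inr k)))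
      (colNormal (κ ⊕ κ') ι) ((colNormal κ ι).prod (colNormal κ' ι)) := by
  refine MeasurePreserving.symm
    (MeasurableEquiv.sumPiEquivProdPi fun _ : κ ⊕ κ' => ι → ℝ).symm
    ⟨MeasurableEquiv.measurable _, ?_⟩
  refine (Measure.pi_eq fun s hs => ?_).symm
  rw [MeasurableEquiv.map_apply]
  have : (MeasurableEquiv.sumPiEquivProdPi fun _ : κ ⊕ κ' => ι → ℝ).symm ⁻¹' Set.univ.pi s
      = (Set.univ.pi fun k => s (.inl k)) ×ˢ (Set.univ.pi fun k => s (.inr k)) := by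
    ext z
    simp [Equiv.sumPiEquivProdPi, MeasurableEquiv.coe_sumPiEquivProdPi_symm]
  rw [this, Measure.prod_prod, colNormal, colNormal, Measure.pi_pi, Measure.pi_pi,
    Fintype.prod_sum_type]

/-- On the stacked vector of all entries the map is the Kronecker product of O with the identity,
which again has orthonormal rows. -/
theorem measurePreserving_mul_colNormal [DecidableEq ι] [DecidableEq κ'] (O : Matrix κ' κ ℝ)
    (hO : O * Oᵀ = 1) :
    MeasurePreserving (fun (z : κ → ι → ℝ) l i => ∑ k, O l k * z k i)
      (colNormal κ ι) (colNormal κ' ι) := by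
  have h1 := measurePreserving_mulVec (kronecker O (1 : Matrix ι ι ℝ)) (by
    have ht : (kronecker O (1 : Matrix ι ι ℝ))ᵀ = kronecker Oᵀ (1 : Matrix ι ι ℝ) := by
      rw [← transpose_one, kronecker, kronecker, kroneckerMap_transpose, transpose_one]
    rw [ht]
    exact (mul_kronecker_mul O Oᵀ 1 1).symm.trans (by rw [hO, one_mul, one_kronecker_one]))
  have h2 := (measurePreserving_curry_stdNormal (κ := κ') (ι := ι)).comp
    (h1.comp ((measurePreserving_curry_stdNormal (κ := κ) (ι := ι)).symm))
  convert h2 using 1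
  ext z l i
  simp only [Function.comp_apply, MeasurableEquiv.coe_curry, Function.curry, mulVec, dotProduct,
    Fintype.sum_prod_type, kronecker, kroneckerMap_apply, MeasurableEquiv.coe_curry_symm,
    Function.uncurry, one_apply]
  simp

theorem measurePreserving_pair_colNormal {k l : κ} (hkl : k ≠ l) :
    MeasurePreserving (fun w : κ → ι → ℝ => (w k, w l)) (colNormal κ ι)
      ((stdNormal ι).prod (stdNormal ι)) := by
  have hind : iIndepFun (fun (k : κ) (w : κ → ι → ℝ) => w k) (colNormal κ ι) :=
    iIndepFun_pi (X := fun _ x => x) (fun i => by fun_prop)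
  have hev : ∀ k : κ, (colNormal κ ι).map (fun w => w k) = stdNormal ι := fun k =>
    (measurePreserving_eval (fun _ : κ => stdNormal ι) k).map_eq
  refine ⟨by fun_prop, ?_⟩
  rw [(indepFun_iff_map_prod_eq_prod_map_map (measurable_pi_apply k).aemeasurable
    (measurable_pi_apply l).aemeasurable).1 (hind.indepFun hkl), hev, hev]

/-! ### Second moments of the trailing sample covariance matrix -/

variable [DecidableEq ι]

theorem finiteMoments_bilin (M : Matrix ι ι ℝ) (k l : κ) :
    FiniteMoments (fun w : κ → ι → ℝ => w k ⬝ᵥ M *ᵥ w l) (colNormal κ ι) := by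
  simp only [dotProduct, mulVec]
  exact .sum _ fun i => (finiteMoments_colNormal k i).mul
    (.sum _ fun j => (finiteMoments_colNormal l j).const_mul _)

theorem integral_colNormal_eval (k : κ) {f : (ι → ℝ) → ℝ} (hf : Measurable f) :
    ∫ w, f (w k) ∂(colNormal κ ι) = ∫ v, f v ∂(stdNormal ι) := by
  have h := measurePreserving_eval (fun _ : κ => stdNormal ι) k
  rw [← h.map_eq, integral_map h.measurable.aemeasurable hf.aestronglyMeasurable]
  rfl

/-- For k ≠ l, fix v = w l: the square is the quadratic form of w k with matrix (Mv)(Mv)ᵀ, whose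
mean is vᵀM²v, and this has mean tr M². On the diagonal one copy of tr M² is already counted, hence
`kurt - 2`. -/
theorem integral_sq_bilin [DecidableEq κ] (M : Matrix ι ι ℝ) (hM : M.IsHermitian) (k l : κ) :
    ∫ w, (w k ⬝ᵥ M *ᵥ w l) ^ 2 ∂(colNormal κ ι)
      = (M * M).trace + if k = l then M.trace ^ 2 + (kurt - 2) * (M * M).trace else 0 := by
  split_ifs with h
  · subst h
    rw [integral_colNormal_eval k (f := fun v => (v ⬝ᵥ M *ᵥ v) ^ 2)
      (by simp only [dotProduct, mulVec]; fun_prop), integral_sq_quadForm M hM]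
    ring
  · have hp := measurePreserving_pair_colNormal (ι := ι) h
    have hmeas : Measurable fun y : (ι → ℝ) × (ι → ℝ) => (y.1 ⬝ᵥ M *ᵥ y.2) ^ 2 := by
      simp only [dotProduct, mulVec]; fun_prop
    have hFm : FiniteMoments (fun y : (ι → ℝ) × (ι → ℝ) => (y.1 ⬝ᵥ M *ᵥ y.2) ^ 2)
        ((stdNormal ι).prod (stdNormal ι)) := by
      refine .pow ?_ 2
      simp only [dotProduct, mulVec]
      exact .sum _ fun i => ((finiteMoments_eval i).comp measurePreserving_fst).mul
        (.sum _ fun j => ((finiteMoments_eval j).comp measurePreserving_snd).const_mul _)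
    have e1 : ∫ w, (w k ⬝ᵥ M *ᵥ w l) ^ 2 ∂(colNormal κ ι)
        = ∫ y, (y.1 ⬝ᵥ M *ᵥ y.2) ^ 2 ∂((stdNormal ι).prod (stdNormal ι)) := by
      rw [← hp.map_eq, integral_map hp.measurable.aemeasurable hmeas.aestronglyMeasurable]
    rw [e1, integral_prod_symm _ hFm.integrable]
    have hMt : Mᵀ = M := by rwa [IsHermitian, conjTranspose_eq_transpose_of_trivial] at hM
    have e2 : ∀ u v : ι → ℝ, (u ⬝ᵥ M *ᵥ v) ^ 2
        = u ⬝ᵥ (vecMulVec (M *ᵥ v) (M *ᵥ v)) *ᵥ u := by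
      intro u v
      rw [vecMulVec_mulVec]
      simp [dotProduct_comm u, sq]
    have e3 : ∀ v : ι → ℝ, (vecMulVec (M *ᵥ v) (M *ᵥ v)).trace = v ⬝ᵥ (M * M) *ᵥ v := by
      intro v
      rw [trace_vecMulVec, ← mulVec_mulVec, dotProduct_mulVec v, ← mulVec_transpose, hMt]
    simp only [e2, integral_quadForm, e3, add_zero]

theorem trace_mul_gram_mul_mul_gram {M : Matrix ι ι ℝ} (w : κ → ι → ℝ) :
    (M * gram w * (M * gram w)).trace
      = (Fintype.card ι : ℝ)⁻¹ ^ 2 * ∑ k, ∑ l, (w k ⬝ᵥ M *ᵥ w l) * (w l ⬝ᵥ M *ᵥ w k) := by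
  rw [← mul_assoc, trace_mul_gram, sq, mul_assoc (Fintype.card ι : ℝ)⁻¹]
  congr 1
  rw [Finset.mul_sum]
  refine Finset.sum_congr rfl fun k _ => ?_
  rw [← mulVec_mulVec, ← mulVec_mulVec, gram, smul_mulVec, mulVec_smul, dotProduct_smul,
    smul_eq_mul, sum_mulVec, mulVec_sum, dotProduct_sum]
  congr 1
  refine Finset.sum_congr rfl fun l _ => ?_
  rw [vecMulVec_mulVec]
  simp [mulVec_smul, mul_comm]

theorem integral_trace_mul_gram (M : Matrix ι ι ℝ) :
    ∫ w : κ → ι → ℝ, (M * gram w).trace ∂(colNormal κ ι)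
      = Fintype.card κ / Fintype.card ι * M.trace := by
  simp only [trace_mul_gram]
  rw [integral_const_mul, integral_finsetSum _ fun k _ => (finiteMoments_bilin M k k).integrable]
  have : ∀ k : κ, ∫ w : κ → ι → ℝ, w k ⬝ᵥ M *ᵥ w k ∂(colNormal κ ι) = M.trace := fun k => by
    rw [integral_colNormal_eval k (f := fun v => v ⬝ᵥ M *ᵥ v)
      (by simp only [dotProduct, mulVec]; fun_prop), integral_quadForm]
  simp only [this, Finset.sum_const, Finset.card_univ, nsmul_eq_mul]
  ring

/-- All pairs of columns contribute tr M², and the diagonal pairs contribute the extra term of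
`integral_sq_bilin`. The (tr M)² part is of the same order as the rest and produces the squared
`thetaBar 1` in the limit. -/
theorem integral_trace_mul_gram_sq [DecidableEq κ] (M : Matrix ι ι ℝ) (hM : M.IsHermitian) :
    ∫ w : κ → ι → ℝ, (M * gram w * (M * gram w)).trace ∂(colNormal κ ι)
      = (Fintype.card ι : ℝ)⁻¹ ^ 2 * (Fintype.card κ * (Fintype.card κ + kurt - 2)
          * (M * M).trace + Fintype.card κ * M.trace ^ 2) := by
  have hMt : Mᵀ = M := by rwa [IsHermitian, conjTranspose_eq_transpose_of_trivial] at hM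
  have e : ∀ (w : κ → ι → ℝ) k l, (w k ⬝ᵥ M *ᵥ w l) * (w l ⬝ᵥ M *ᵥ w k)
      = (w k ⬝ᵥ M *ᵥ w l) ^ 2 := by
    intro w k l
    rw [dotProduct_mulVec (w l), ← mulVec_transpose, hMt, dotProduct_comm (M *ᵥ w l), sq]
  simp only [trace_mul_gram_mul_mul_gram, e]
  have hi : ∀ k l : κ, FiniteMoments (fun w : κ → ι → ℝ => (w k ⬝ᵥ M *ᵥ w l) ^ 2)
      (colNormal κ ι) := fun k l => (finiteMoments_bilin M k l).pow 2
  rw [integral_const_mul, integral_finsetSum _ fun k _ =>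
    (FiniteMoments.sum _ fun l => hi k l).integrable]
  congr 1
  have e2 : ∀ k : κ, ∫ w : κ → ι → ℝ, ∑ l, (w k ⬝ᵥ M *ᵥ w l) ^ 2 ∂(colNormal κ ι)
      = Fintype.card κ * (M * M).trace + (M.trace ^ 2 + (kurt - 2) * (M * M).trace) := by
    intro k
    rw [integral_finsetSum _ fun l _ => (hi k l).integrable]
    simp only [integral_sq_bilin M hM, Finset.sum_add_distrib, Finset.sum_const,
      Finset.card_univ, nsmul_eq_mul, Finset.sum_ite_eq, Finset.mem_univ, if_true]
  simp only [e2, Finset.sum_const, Finset.card_univ, nsmul_eq_mul]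
  ring

/-- Risk as a function of the sketched columns `z` and the complementary columns `w`. -/
noncomputable def splitRisk (α σ lam : ℝ) (z : κ → ι → ℝ) (w : κ' → ι → ℝ) : ℝ :=
  α ^ 2 / (Fintype.card κ + Fintype.card κ')
      * (Fintype.card κ + Fintype.card κ' - Fintype.card ι
        + lam ^ 2 * (resolvent (gram z) lam * resolvent (gram z) lam).trace
        - 2 * lam * (resolvent (gram z) lam * resolvent (gram z) lam * gram w).trace
        + (resolvent (gram z) lam * gram w * (resolvent (gram z) lam * gram w)).trace)
    + σ ^ 2 * (Fintype.card ι : ℝ)⁻¹ * ((resolvent (gram z) lam).trace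
        - lam * (resolvent (gram z) lam * resolvent (gram z) lam).trace
        + (resolvent (gram z) lam * resolvent (gram z) lam * gram w).trace)

/-- The normalized trace of the squared resolvent. -/
noncomputable def stieltjesSq (lam : ℝ) (z : κ → ι → ℝ) : ℝ :=
  (resolvent (gram z) lam * resolvent (gram z) lam).trace / Fintype.card ι

theorem finiteMoments_stieltjesSq {lam : ℝ} (hlam : 0 < lam) :
    FiniteMoments (fun z : κ → ι → ℝ => stieltjesSq lam z) (colNormal κ ι) := by
  simp only [stieltjesSq, div_eq_inv_mul]
  exact ((finiteMomentsMat_resolvent_gram hlam).mul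
    (finiteMomentsMat_resolvent_gram hlam)).trace.const_mul _

theorem finiteMomentsMat_gram :
    FiniteMomentsMat (fun z : κ → ι → ℝ => gram z) (colNormal κ ι) := fun i j => by
  simp only [gram_apply]
  exact (FiniteMoments.sum _ fun k =>
    (finiteMoments_colNormal k i).mul (finiteMoments_colNormal k j)).const_mul _

theorem FiniteMomentsMat.comp {Ω Ω' m n : Type*} [MeasurableSpace Ω] [MeasurableSpace Ω']
    {μ : Measure Ω} {ν : Measure Ω'} {M : Ω → Matrix m n ℝ} (hM : FiniteMomentsMat M μ)
    {φ : Ω' → Ω} (hφ : MeasurePreserving φ ν μ) :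
    FiniteMomentsMat (fun ω => M (φ ω)) ν := fun i j => (hM i j).comp hφ

theorem integrable_splitRisk (α σ : ℝ) {lam : ℝ} (hlam : 0 < lam) :
    Integrable (fun y : (κ → ι → ℝ) × (κ' → ι → ℝ) => splitRisk α σ lam y.1 y.2)
      ((colNormal κ ι).prod (colNormal κ' ι)) := by
  have hQ : FiniteMomentsMat (fun y : (κ → ι → ℝ) × (κ' → ι → ℝ) => resolvent (gram y.1) lam)
      ((colNormal κ ι).prod (colNormal κ' ι)) :=
    (finiteMomentsMat_resolvent_gram hlam).comp measurePreserving_fst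
  have hB : FiniteMomentsMat (fun y : (κ → ι → ℝ) × (κ' → ι → ℝ) => gram y.2)
      ((colNormal κ ι).prod (colNormal κ' ι)) :=
    finiteMomentsMat_gram.comp measurePreserving_snd
  refine FiniteMoments.integrable ?_
  unfold splitRisk
  exact (((((FiniteMoments.const _).add ((hQ.mul hQ).trace.const_mul _)).sub
    (((hQ.mul hQ).mul hB).trace.const_mul _)).add ((hQ.mul hB).mul (hQ.mul hB)).trace).const_mul
      _).add (((hQ.trace.sub ((hQ.mul hQ).trace.const_mul _)).add
        ((hQ.mul hQ).mul hB).trace).const_mul _)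

/-- With z frozen Q is a constant matrix, and the risk is affine in tr(Q²B) and tr(QBQB), whose
means are known. -/
theorem integral_splitRisk_right [DecidableEq κ'] [Nonempty ι] (α σ : ℝ) {lam : ℝ}
    (hlam : 0 < lam) (z : κ → ι → ℝ) :
    ∫ w : κ' → ι → ℝ, splitRisk α σ lam z w ∂(colNormal κ' ι)
      = α ^ 2 / (Fintype.card κ + Fintype.card κ')
          * (Fintype.card κ + Fintype.card κ' - Fintype.card ι
            + (lam ^ 2 * Fintype.card ι - 2 * lam * Fintype.card κ'
              + Fintype.card κ' * (Fintype.card κ' + kurt - 2) / Fintype.card ι)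
              * stieltjesSq lam z + Fintype.card κ' * stieltjes lam z ^ 2)
        + σ ^ 2 * (stieltjes lam z
          + (Fintype.card κ' / Fintype.card ι - lam) * stieltjesSq lam z) := by
  have hn : (Fintype.card ι : ℝ) ≠ 0 := by simp
  have hQh := (posSemidef_resolvent (posSemidef_gram z) hlam).isHermitian
  set Q := resolvent (gram z) lam with hQ
  have hB := finiteMomentsMat_gram (κ := κ') (ι := ι)
  have hQm : FiniteMomentsMat (fun _ : κ' → ι → ℝ => Q) (colNormal κ' ι) := .const Q
  have i1 := ((hQm.mul hQm).mul hB).trace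
  have i2 := ((hQm.mul hB).mul (hQm.mul hB)).trace
  have e : ∀ w : κ' → ι → ℝ, splitRisk α σ lam z w
      = (α ^ 2 / (Fintype.card κ + Fintype.card κ')
            * (Fintype.card κ + Fintype.card κ' - Fintype.card ι + lam ^ 2 * (Q * Q).trace)
          + σ ^ 2 * (Fintype.card ι : ℝ)⁻¹ * (Q.trace - lam * (Q * Q).trace))
        + ((σ ^ 2 * (Fintype.card ι : ℝ)⁻¹
              - 2 * lam * (α ^ 2 / (Fintype.card κ + Fintype.card κ'))) * (Q * Q * gram w).trace
          + α ^ 2 / (Fintype.card κ + Fintype.card κ') * (Q * gram w * (Q * gram w)).trace) := by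
    intro w
    simp only [splitRisk, ← hQ]
    ring
  simp only [e]
  rw [integral_add (integrable_const _) ((i1.const_mul _).add (i2.const_mul _)).integrable,
    integral_add (i1.const_mul _).integrable (i2.const_mul _).integrable, integral_const_mul, integral_const_mul,
    integral_trace_mul_gram, integral_trace_mul_gram_sq Q hQh]
  simp only [integral_const, probReal_univ, one_smul, stieltjes, stieltjesSq, ← hQ]
  field_simp
  ring

/-- Expected risk over both groups of columns. -/
theorem integral_splitRisk [DecidableEq κ'] [Nonempty ι] (α σ : ℝ) {lam : ℝ} (hlam : 0 < lam) :
    ∫ y : (κ → ι → ℝ) × (κ' → ι → ℝ), splitRisk α σ lam y.1 y.2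
        ∂((colNormal κ ι).prod (colNormal κ' ι))
      = α ^ 2 / (Fintype.card κ + Fintype.card κ')
          * (Fintype.card κ + Fintype.card κ' - Fintype.card ι
            + (lam ^ 2 * Fintype.card ι - 2 * lam * Fintype.card κ'
              + Fintype.card κ' * (Fintype.card κ' + kurt - 2) / Fintype.card ι)
              * (∫ z : κ → ι → ℝ, stieltjesSq lam z ∂(colNormal κ ι))
            + Fintype.card κ' * ∫ z : κ → ι → ℝ, stieltjes lam z ^ 2 ∂(colNormal κ ι))
        + σ ^ 2 * ((∫ z : κ → ι → ℝ, stieltjes lam z ∂(colNormal κ ι))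
          + (Fintype.card κ' / Fintype.card ι - lam)
            * ∫ z : κ → ι → ℝ, stieltjesSq lam z ∂(colNormal κ ι)) := by
  rw [integral_prod _ (integrable_splitRisk α σ hlam)]
  simp only [integral_splitRisk_right α σ hlam]
  have h1 := finiteMoments_stieltjes (κ := κ) (ι := ι) hlam
  have h2 := finiteMoments_stieltjesSq (κ := κ) (ι := ι) hlam
  have i1 := ((FiniteMoments.const (μ := colNormal κ ι) ((Fintype.card κ : ℝ) + Fintype.card κ'
    - Fintype.card ι)).add (h2.const_mul (lam ^ 2 * Fintype.card ι - 2 * lam * Fintype.card κ'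
              + Fintype.card κ' * (Fintype.card κ' + kurt - 2) / Fintype.card ι)))
  have i2 := (h1.pow 2).const_mul (Fintype.card κ' : ℝ)
  have i3 := h2.const_mul ((Fintype.card κ' : ℝ) / Fintype.card ι - lam)
  rw [integral_add ((i1.add i2).const_mul _).integrable ((h1.add i3).const_mul _).integrable,
    integral_const_mul, integral_const_mul, integral_add i1.integrable i2.integrable,
    integral_add h1.integrable i3.integrable, integral_add (integrable_const _)
      (h2.const_mul _).integrable, integral_const_mul, integral_const_mul, integral_const_mul]
  simp

end GaussianMatrix

/-! ### The conditional risk given the design and the sketch -/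

section Risk

variable {n p d : ℕ}

/-- The resolvent of the sketched sample covariance matrix `n⁻¹ X R Rᵀ Xᵀ`. -/
noncomputable def sketchResolvent (lam : ℝ) (x : Matrix (Fin n) (Fin p) ℝ)
    (r : Matrix (Fin p) (Fin d) ℝ) : Matrix (Fin n) (Fin n) ℝ :=
  resolvent ((n : ℝ)⁻¹ • (x * r * rᵀ * xᵀ)) lam

/-- The matrix mapping the coefficients to the bias of the estimator. -/
noncomputable def biasMat (lam : ℝ) (x : Matrix (Fin n) (Fin p) ℝ)
    (r : Matrix (Fin p) (Fin d) ℝ) : Matrix (Fin p) (Fin p) ℝ :=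
  (n : ℝ)⁻¹ • (xᵀ * sketchResolvent lam x r * x) - 1

/-- The matrix mapping the noise to the estimator. -/
noncomputable def noiseMat (lam : ℝ) (x : Matrix (Fin n) (Fin p) ℝ)
    (r : Matrix (Fin p) (Fin d) ℝ) : Matrix (Fin p) (Fin n) ℝ :=
  (n : ℝ)⁻¹ • (xᵀ * sketchResolvent lam x r)

/-- Expected squared error given the design and the sketch. -/
noncomputable def condRisk (α σ lam : ℝ) (x : Matrix (Fin n) (Fin p) ℝ)
    (r : Matrix (Fin p) (Fin d) ℝ) : ℝ :=
  α ^ 2 / p * (∑ j, ∑ i, biasMat lam x r j i ^ 2) + σ ^ 2 * ∑ j, ∑ l, noiseMat lam x r j l ^ 2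

/-- Stacking β and ε into one vector lets a single second-moment computation treat the bias, the
noise and their cross terms. -/
theorem squaredError_eq (lam : ℝ) (x : Matrix (Fin n) (Fin p) ℝ) (r : Matrix (Fin p) (Fin d) ℝ)
    (β : Fin p → ℝ) (ε : Fin n → ℝ) :
    squaredError x r β ε lam
      = ∑ j, (∑ a : Fin p ⊕ Fin n, Sum.elim (biasMat lam x r j) (noiseMat lam x r j) a
          * Sum.elim β ε a) ^ 2 := by
  have h : dualSketchedRidge x r (x *ᵥ β + ε) lam - β
      = biasMat lam x r *ᵥ β + noiseMat lam x r *ᵥ ε := by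
    simp only [dualSketchedRidge, biasMat, noiseMat, sketchResolvent, resolvent, mulVec_add,
      mulVec_mulVec, sub_mulVec, smul_mulVec, one_mulVec, smul_add, Matrix.mul_assoc]
    rw [add_sub_right_comm]
  refine Finset.sum_congr rfl fun j _ => ?_
  rw [Fintype.sum_sum_type]
  exact congrArg (· ^ 2) (congrFun h j)

theorem posSemidef_sketch (x : Matrix (Fin n) (Fin p) ℝ) (r : Matrix (Fin p) (Fin d) ℝ) :
    ((n : ℝ)⁻¹ • (x * r * rᵀ * xᵀ)).PosSemidef := by
  have := posSemidef_self_mul_conjTranspose (x * r)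
  rw [conjTranspose_eq_transpose_of_trivial, transpose_mul, ← Matrix.mul_assoc] at this
  exact this.smul (by positivity)

theorem sum_sq_eq_trace {m l : Type*} [Fintype m] [Fintype l] (M : Matrix m l ℝ) :
    ∑ i, ∑ j, M i j ^ 2 = (Mᵀ * M).trace := by
  simp only [trace, diag, mul_apply, transpose_apply, sq]
  exact Finset.sum_comm

theorem gram_transpose {κ : Type*} [Fintype κ] (y : Matrix (Fin n) κ ℝ) :
    gram (fun k i => y i k) = (n : ℝ)⁻¹ • (y * yᵀ) := by
  ext i j
  simp [gram_apply, mul_apply]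

/-- Everything follows from n⁻¹ x xᵀ = A + B, hence Q (n⁻¹ x xᵀ) = 1 - lam Q + Q B, and cyclicity of
the trace. -/
theorem condRisk_eq_splitRisk {m : ℕ} (hdm : d + m = p) (α σ : ℝ) {lam : ℝ} (hlam : 0 < lam)
    (x : Matrix (Fin n) (Fin p) ℝ) (r : Matrix (Fin p) (Fin d) ℝ) (r' : Matrix (Fin p) (Fin m) ℝ)
    (h : r * rᵀ + r' * r'ᵀ = 1) :
    condRisk α σ lam x r
      = splitRisk α σ lam (fun k i => (x * r) i k) (fun k i => (x * r') i k) := by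
  rw [splitRisk, condRisk, sum_sq_eq_trace, sum_sq_eq_trace]
  have hp : ((Fintype.card (Fin d) : ℝ) + Fintype.card (Fin m)) = p := by
    simp only [Fintype.card_fin]; exact_mod_cast hdm
  have hA : (n : ℝ)⁻¹ • (x * r * rᵀ * xᵀ) = gram (fun k i => (x * r) i k) := by
    rw [gram_transpose, transpose_mul, ← Matrix.mul_assoc]
  have hS : (n : ℝ)⁻¹ • (x * xᵀ)
      = gram (fun k i => (x * r) i k) + gram (fun k i => (x * r') i k) := by
    rw [gram_transpose, gram_transpose, transpose_mul, transpose_mul, ← smul_add]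
    congr 1
    calc x * xᵀ = x * (r * rᵀ + r' * r'ᵀ) * xᵀ := by rw [h, Matrix.mul_one]
      _ = _ := by simp only [Matrix.mul_add, Matrix.add_mul, Matrix.mul_assoc]
  have hpos := posSemidef_gram (fun k i => (x * r) i k)
  rw [hp, biasMat, noiseMat, sketchResolvent, hA]
  set A := gram (fun k i => (x * r) i k)
  set B := gram (fun k i => (x * r') i k)
  set Q := resolvent A lam with hQ
  have hQt : Qᵀ = Q := transpose_resolvent hpos hlam
  have hQS : Q * ((n : ℝ)⁻¹ • (x * xᵀ)) = 1 - lam • Q + Q * B := by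
    rw [hS, Matrix.mul_add, resolvent_mul hpos hlam]
  set c := (n : ℝ)⁻¹
  have t1 : (c • (xᵀ * Q * x)).trace = (n : ℝ) - lam * Q.trace + (Q * B).trace := by
    have : (c • (xᵀ * Q * x)).trace = (Q * (c • (x * xᵀ))).trace := by
      rw [Matrix.mul_smul, trace_smul, trace_smul, Matrix.mul_assoc, trace_mul_comm, Matrix.mul_assoc]
    rw [this, hQS, trace_add, trace_sub, trace_one, trace_smul, smul_eq_mul, Fintype.card_fin]
  have t2 : (c • (xᵀ * Q * x) * (c • (xᵀ * Q * x))).trace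
      = n + lam ^ 2 * (Q * Q).trace + (Q * B * (Q * B)).trace - 2 * lam * Q.trace
        + 2 * (Q * B).trace - 2 * lam * (Q * Q * B).trace := by
    have : (c • (xᵀ * Q * x) * (c • (xᵀ * Q * x))).trace
        = (Q * (c • (x * xᵀ)) * (Q * (c • (x * xᵀ)))).trace := by
      simp only [Matrix.mul_smul, Matrix.smul_mul, trace_smul]
      rw [Matrix.mul_assoc xᵀ, Matrix.mul_assoc xᵀ, trace_mul_comm]
      simp only [Matrix.mul_assoc]
    rw [this, hQS]
    simp only [Matrix.mul_add, Matrix.add_mul, Matrix.mul_sub, Matrix.sub_mul, Matrix.mul_one, Matrix.one_mul, Matrix.mul_smul,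
      Matrix.smul_mul, trace_add, trace_sub, trace_smul, trace_one, Fintype.card_fin, smul_eq_mul]
    rw [trace_mul_comm (Q * B) Q, ← Matrix.mul_assoc Q Q B]
    ring
  -- The bias matrix is symmetric, so this is `t2` minus twice `t1` plus p; the terms in tr Q and
  -- tr(QB) cancel.
  have t3 : ((c • (xᵀ * Q * x) - 1)ᵀ * (c • (xᵀ * Q * x) - 1)).trace
      = (p : ℝ) - n + lam ^ 2 * (Q * Q).trace - 2 * lam * (Q * Q * B).trace
        + (Q * B * (Q * B)).trace := by
    have : (c • (xᵀ * Q * x) - 1)ᵀ = c • (xᵀ * Q * x) - 1 := by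
      rw [transpose_sub, transpose_one, transpose_smul, transpose_mul, transpose_mul, hQt,
        transpose_transpose, Matrix.mul_assoc]
    rw [this, Matrix.sub_mul, Matrix.mul_sub, Matrix.one_mul, Matrix.mul_one, trace_sub, trace_sub, trace_sub, t2, t1,
      trace_one, Fintype.card_fin]
    ring
  have t4 : ((c • (xᵀ * Q))ᵀ * (c • (xᵀ * Q))).trace
      = c * (Q.trace - lam * (Q * Q).trace + (Q * Q * B).trace) := by
    have : (c • (xᵀ * Q))ᵀ * (c • (xᵀ * Q)) = c • (Q * (c • (x * xᵀ)) * Q) := by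
      rw [transpose_smul, transpose_mul, hQt, transpose_transpose]
      simp only [Matrix.mul_smul, Matrix.smul_mul, Matrix.mul_assoc]
    rw [this, hQS, trace_smul, smul_eq_mul, Matrix.add_mul, Matrix.sub_mul, Matrix.one_mul, Matrix.smul_mul, trace_add,
      trace_sub, trace_smul, smul_eq_mul, trace_mul_comm (Q * B) Q, ← Matrix.mul_assoc]
  rw [t3, t4, Fintype.card_fin]
  ring

theorem exists_orthogonal_extension {m : ℕ} (hdm : d + m = p) (r : Matrix (Fin p) (Fin d) ℝ)
    (hr : rᵀ * r = 1) :
    ∃ O : Matrix (Fin d ⊕ Fin m) (Fin p) ℝ, O * Oᵀ = 1 ∧ Oᵀ * O = 1 ∧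
      ∀ k j, O (.inl k) j = r j k := by
  -- The zeros on the right summand are placeholders: orthonormality is required only on the left,
  -- and the extension overwrites the rest.
  set v : Fin d ⊕ Fin m → EuclideanSpace ℝ (Fin p) :=
    Sum.elim (fun k => WithLp.toLp 2 fun j => r j k) 0 with hv
  have hon : Orthonormal ℝ ((Set.range Sum.inl).domRestrict v) := by
    rw [orthonormal_iff_ite]
    rintro ⟨_, k, rfl⟩ ⟨_, l, rfl⟩
    have := congrFun (congrFun hr k) l
    simp only [mul_apply, transpose_apply, one_apply] at this
    simp only [Set.domRestrict_apply, hv, Sum.elim_inl, PiLp.inner_apply, RCLike.inner_apply,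
      conj_trivial]
    refine ((Finset.sum_congr rfl fun j _ => mul_comm _ _).trans this).trans ?_
    exact if_congr ⟨fun h => Subtype.ext (congrArg Sum.inl h),
      fun h => Sum.inl_injective (congrArg Subtype.val h)⟩ rfl rfl
  obtain ⟨b, hb⟩ := hon.exists_orthonormalBasis_extension_of_card_eq (by simp [hdm])
  have h1 : (of fun l j => b l j : Matrix (Fin d ⊕ Fin m) (Fin p) ℝ)
      * (of fun l j => b l j : Matrix (Fin d ⊕ Fin m) (Fin p) ℝ)ᵀ = 1 := by
    ext l l'
    have := orthonormal_iff_ite.1 b.orthonormal l l'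
    simp only [PiLp.inner_apply, RCLike.inner_apply, conj_trivial] at this
    rw [mul_apply, one_apply, ← this]
    exact Finset.sum_congr rfl fun j _ => mul_comm _ _
  refine ⟨of fun l j => b l j, h1, ?_, fun k j => ?_⟩
  · exact (mul_eq_one_comm_of_card_eq _ _ _ (by simp [hdm])).1 h1
  · rw [of_apply, hb _ ⟨k, rfl⟩]
    rfl

theorem le_of_transpose_mul_self_eq_one (r : Matrix (Fin p) (Fin d) ℝ) (hr : rᵀ * r = 1) :
    d ≤ p := by
  have h := rank_mul_le_right rᵀ r
  rw [hr, rank_one, Fintype.card_fin] at h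
  exact h.trans (by simpa using rank_le_card_height r)

/-- For a Gaussian design the expected conditional risk does not depend on the orthogonal
sketch. -/
theorem integral_condRisk {m : ℕ} (hdm : d + m = p) (α σ : ℝ) {lam : ℝ} (hlam : 0 < lam)
    (r : Matrix (Fin p) (Fin d) ℝ) (hr : rᵀ * r = 1) :
    ∫ y : Fin p → Fin n → ℝ, condRisk α σ lam (of fun i k => y k i) r
        ∂(colNormal (Fin p) (Fin n))
      = ∫ y : (Fin d → Fin n → ℝ) × (Fin m → Fin n → ℝ), splitRisk α σ lam y.1 y.2
        ∂((colNormal (Fin d) (Fin n)).prod (colNormal (Fin m) (Fin n))) := by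
  obtain ⟨O, hO1, hO2, hO3⟩ := exists_orthogonal_extension hdm r hr
  have hp := (measurePreserving_sum_colNormal (ι := Fin n) (κ := Fin d) (κ' := Fin m)).comp
    (measurePreserving_mul_colNormal (ι := Fin n) O hO1)
  have hi := integrable_splitRisk (κ := Fin d) (κ' := Fin m) (ι := Fin n) α σ hlam
  rw [← hp.map_eq] at hi ⊢
  rw [integral_map hp.measurable.aemeasurable hi.aestronglyMeasurable]
  refine integral_congr_ae (ae_of_all _ fun y => ?_)
  have h : r * rᵀ + (of fun j k => O (.inr k) j : Matrix (Fin p) (Fin m) ℝ)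
      * (of fun j k => O (.inr k) j : Matrix (Fin p) (Fin m) ℝ)ᵀ = 1 := by
    rw [← hO2]
    ext i j
    simp [mul_apply, hO3]
  simp only
  rw [condRisk_eq_splitRisk hdm α σ hlam _ r _ h]
  congr 1
  · ext k i
    simp [mul_apply, hO3, mul_comm]
  · ext k i
    simp [mul_apply, mul_comm]

end Risk

/-! ### Measurability and moments of the risk matrices -/

section Moments

variable {Ω : Type*} [MeasurableSpace Ω] {n p d : ℕ}
  {x : Ω → Matrix (Fin n) (Fin p) ℝ} {r : Ω → Matrix (Fin p) (Fin d) ℝ}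

theorem measurable_mul_apply {m k l : Type*} [Fintype k] {M : Ω → Matrix m k ℝ}
    {N : Ω → Matrix k l ℝ} (hM : ∀ i j, Measurable fun ω => M ω i j)
    (hN : ∀ i j, Measurable fun ω => N ω i j) (i : m) (j : l) :
    Measurable fun ω => (M ω * N ω) i j := by
  simp only [mul_apply]
  exact Finset.measurable_sum _ fun k _ => (hM i k).mul (hN k j)

theorem measurable_sketch (hx : ∀ i j, Measurable fun ω => x ω i j)
    (hr : ∀ i j, Measurable fun ω => r ω i j) (i j : Fin n) :
    Measurable fun ω => ((n : ℝ)⁻¹ • (x ω * r ω * (r ω)ᵀ * (x ω)ᵀ)) i j :=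
  (measurable_mul_apply (measurable_mul_apply (measurable_mul_apply hx hr) fun i j => hr j i)
    (fun i j => hx j i) i j).const_mul _

theorem measurable_noiseMat (lam : ℝ) (hx : ∀ i j, Measurable fun ω => x ω i j)
    (hr : ∀ i j, Measurable fun ω => r ω i j) (j : Fin p) (l : Fin n) :
    Measurable fun ω => noiseMat lam (x ω) (r ω) j l :=
  (measurable_mul_apply (fun i j => hx j i)
    (measurable_resolvent (measurable_sketch hx hr) lam) j l).const_mul _

theorem measurable_biasMat (lam : ℝ) (hx : ∀ i j, Measurable fun ω => x ω i j)
    (hr : ∀ i j, Measurable fun ω => r ω i j) (j i : Fin p) :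
    Measurable fun ω => biasMat lam (x ω) (r ω) j i :=
  ((measurable_mul_apply (measurable_mul_apply (fun i j => hx j i)
    (measurable_resolvent (measurable_sketch hx hr) lam)) hx j i).const_mul _).sub_const _

theorem measurable_condRisk (α σ lam : ℝ) (hx : ∀ i j, Measurable fun ω => x ω i j)
    (hr : ∀ i j, Measurable fun ω => r ω i j) :
    Measurable fun ω => condRisk α σ lam (x ω) (r ω) := by
  refine Measurable.add (.const_mul ?_ _) (.const_mul ?_ _)
  · exact Finset.measurable_sum _ fun j _ => Finset.measurable_sum _ fun i _ =>
      (measurable_biasMat lam hx hr j i).pow_const 2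
  · exact Finset.measurable_sum _ fun j _ => Finset.measurable_sum _ fun i _ =>
      (measurable_noiseMat lam hx hr j i).pow_const 2

theorem finiteMomentsMat_noiseMat {P : Measure Ω} [IsFiniteMeasure P] {lam : ℝ} (hlam : 0 < lam)
    (hx : ∀ i j, Measurable fun ω => x ω i j) (hr : ∀ i j, Measurable fun ω => r ω i j)
    (hxm : FiniteMomentsMat x P) : FiniteMomentsMat (fun ω => noiseMat lam (x ω) (r ω)) P :=
  (hxm.transpose.mul (.resolvent (measurable_sketch hx hr)
    (fun _ => posSemidef_sketch _ _) hlam)).smul _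

theorem finiteMomentsMat_biasMat {P : Measure Ω} [IsFiniteMeasure P] {lam : ℝ} (hlam : 0 < lam)
    (hx : ∀ i j, Measurable fun ω => x ω i j) (hr : ∀ i j, Measurable fun ω => r ω i j)
    (hxm : FiniteMomentsMat x P) : FiniteMomentsMat (fun ω => biasMat lam (x ω) (r ω)) P :=
  (((hxm.transpose.mul (.resolvent (measurable_sketch hx hr)
    (fun _ => posSemidef_sketch _ _) hlam)).mul hxm).smul _).sub (.const 1)

/-- Expected squared norm of a random matrix applied to an independent random vector with
uncorrelated coordinates. -/
theorem integral_sum_sq_of_indepFun {ι κ : Type*} [Fintype ι] [Fintype κ] [DecidableEq κ]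
    {P : Measure Ω} [IsProbabilityMeasure P] {M : Ω → ι → κ → ℝ} {V : Ω → κ → ℝ} {c : κ → ℝ}
    (hMm : ∀ j a, Measurable fun ω => M ω j a) (hVm : ∀ a, Measurable fun ω => V ω a)
    (hind : IndepFun M V P)
    (hM : ∀ j a b, Integrable (fun ω => M ω j a * M ω j b) P)
    (hV : ∀ a, MemLp (fun ω => V ω a) 2 P)
    (hcov : ∀ a b, ∫ ω, V ω a * V ω b ∂P = if a = b then c a else 0) :
    Integrable (fun ω => ∑ j, (∑ a, M ω j a * V ω a) ^ 2) P ∧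
    ∫ ω, ∑ j, (∑ a, M ω j a * V ω a) ^ 2 ∂P = ∑ j, ∑ a, c a * ∫ ω, M ω j a ^ 2 ∂P := by
  have e : ∀ ω, ∑ j, (∑ a, M ω j a * V ω a) ^ 2
      = ∑ j, ∑ a, ∑ b, (M ω j a * M ω j b) * (V ω a * V ω b) := by
    intro ω
    refine Finset.sum_congr rfl fun j _ => ?_
    rw [sq, Finset.sum_mul_sum]
    exact Finset.sum_congr rfl fun a _ => Finset.sum_congr rfl fun b _ => by ring
  have hind2 : ∀ j a b, IndepFun (fun ω => M ω j a * M ω j b) (fun ω => V ω a * V ω b) P :=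
    fun j a b => hind.comp (φ := fun m : ι → κ → ℝ => m j a * m j b)
      (ψ := fun v : κ → ℝ => v a * v b) (by fun_prop) (by fun_prop)
  have hVi : ∀ a b, Integrable (fun ω => V ω a * V ω b) P := fun a b =>
    (hV a).integrable_mul (hV b)
  have hi : ∀ j a b, Integrable (fun ω => (M ω j a * M ω j b) * (V ω a * V ω b)) P :=
    fun j a b => (hind2 j a b).integrable_mul (hM j a b) (hVi a b)
  have hi1 : ∀ j a, Integrable (fun ω => ∑ b, (M ω j a * M ω j b) * (V ω a * V ω b)) P :=
    fun j a => integrable_finsetSum _ fun b _ => hi j a b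
  have hi2 : ∀ j, Integrable (fun ω => ∑ a, ∑ b, (M ω j a * M ω j b) * (V ω a * V ω b)) P :=
    fun j => integrable_finsetSum _ fun a _ => hi1 j a
  simp only [e]
  refine ⟨integrable_finsetSum _ fun j _ => hi2 j, ?_⟩
  rw [integral_finsetSum _ fun j _ => hi2 j]
  refine Finset.sum_congr rfl fun j _ => ?_
  rw [integral_finsetSum _ fun a _ => hi1 j a]
  refine Finset.sum_congr rfl fun a _ => ?_
  rw [integral_finsetSum _ fun b _ => hi j a b]
  have : ∀ b, ∫ ω, (M ω j a * M ω j b) * (V ω a * V ω b) ∂P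
      = if a = b then c a * ∫ ω, M ω j a ^ 2 ∂P else 0 := by
    intro b
    rw [(hind2 j a b).integral_fun_mul_eq_mul_integral
      ((hMm j a).mul (hMm j b)).aestronglyMeasurable
      ((hVm a).mul (hVm b)).aestronglyMeasurable, hcov]
    split_ifs with h
    · subst h; simp only [sq]; ring
    · simp
  simp [this]

/-- The two hypotheses make the joint law a product of three measures, whose factors can be
regrouped. -/
theorem indepFun_of_indepFun_prodMk {A B C : Type*} [MeasurableSpace A] [MeasurableSpace B]
    [MeasurableSpace C] {P : Measure Ω} [IsProbabilityMeasure P] {f : Ω → A} {g : Ω → B}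
    {h : Ω → C} (hf : Measurable f) (hg : Measurable g) (hh : Measurable h)
    (h1 : IndepFun g (fun ω => (f ω, h ω)) P) (h2 : IndepFun f h P) :
    IndepFun f (fun ω => (g ω, h ω)) P := by
  have := Measure.isProbabilityMeasure_map (μ := P) hf.aemeasurable
  have := Measure.isProbabilityMeasure_map (μ := P) hg.aemeasurable
  have := Measure.isProbabilityMeasure_map (μ := P) hh.aemeasurable
  have hgh : IndepFun g h P := h1.comp measurable_id measurable_snd
  rw [indepFun_iff_map_prod_eq_prod_map_map (by fun_prop) (by fun_prop)] at h1 h2 hgh ⊢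
  rw [h2] at h1
  rw [hgh]
  have m1 := (measurePreserving_prodAssoc (P.map g) (P.map f) (P.map h)).symm
  have m2 := (Measure.measurePreserving_swap (μ := P.map g) (ν := P.map f)).prod
    (MeasurePreserving.id (P.map h))
  have m3 := measurePreserving_prodAssoc (P.map f) (P.map g) (P.map h)
  have m := m3.comp (m2.comp m1)
  rw [← m.map_eq, ← h1, Measure.map_map m.measurable (by fun_prop)]
  rfl

end Moments

/-! ### Reduction of the model to independent Gaussian columns -/

namespace IsModel

variable {Ω : Type*} [MeasurableSpace Ω] {P : Measure Ω} [IsProbabilityMeasure P] {n p d : ℕ}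
  {X : Ω → Matrix (Fin n) (Fin p) ℝ} {R : Ω → Matrix (Fin p) (Fin d) ℝ}
  {β : Ω → Fin p → ℝ} {ε : Ω → Fin n → ℝ} {α σ : ℝ}

set_option linter.unusedSectionVars false

theorem measurable_X_apply (h : IsModel P X R β ε α σ) (i : Fin n) (j : Fin p) :
    Measurable fun ω => X ω i j :=
  (measurable_pi_apply j).comp ((measurable_pi_apply i).comp h.measurable_X)

theorem measurable_R_apply (h : IsModel P X R β ε α σ) (i : Fin p) (j : Fin d) :
    Measurable fun ω => R ω i j :=
  (measurable_pi_apply j).comp ((measurable_pi_apply i).comp h.measurable_R)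

theorem finiteMomentsMat_X (h : IsModel P X R β ε α σ) : FiniteMomentsMat X P := fun i j =>
  finiteMoments_gaussianReal.comp ⟨h.measurable_X_apply i j, h.X_gaussian i j⟩

theorem sketch_dim_le (h : IsModel P X R β ε α σ) : d ≤ p := by
  obtain ⟨ω, hω⟩ := h.R_orthogonal.exists
  exact le_of_transpose_mul_self_eq_one _ hω

theorem indepFun_coef_noise (h : IsModel P X R β ε α σ) : IndepFun β ε P :=
  h.indep_β.comp measurable_id measurable_snd

/-- The model gives independence one variable at a time; regrouping twice yields the pair statement
needed to condition on design and sketch together. -/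
theorem indepFun_design_sketch (h : IsModel P X R β ε α σ) :
    IndepFun (fun ω => (R ω, X ω)) (fun ω => (β ω, ε ω)) P := by
  have hX := h.measurable_X
  have hβ := h.measurable_β
  have hε := h.measurable_ε
  have h1 : IndepFun X (fun ω => (β ω, ε ω)) P :=
    indepFun_of_indepFun_prodMk hX hβ hε h.indep_β h.indep_X_ε
  have h2 : IndepFun R (fun ω => ((β ω, ε ω), X ω)) P :=
    h.indep_R.comp measurable_id
      (measurable_swap : Measurable (Prod.swap : Matrix (Fin n) (Fin p) ℝ × _ → _))
  exact (indepFun_of_indepFun_prodMk (hβ.prodMk hε) h.measurable_R hX h2 h1.symm).symm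

theorem integral_coef_noise_mul (h : IsModel P X R β ε α σ) (a b : Fin p ⊕ Fin n) :
    ∫ ω, Sum.elim (β ω) (ε ω) a * Sum.elim (β ω) (ε ω) b ∂P
      = if a = b then Sum.elim (fun _ => α ^ 2 / p) (fun _ => σ ^ 2) a else 0 := by
  have hβm : ∀ i, Measurable fun ω => β ω i := fun i =>
    (measurable_pi_apply i).comp h.measurable_β
  have hεm : ∀ i, Measurable fun ω => ε ω i := fun i =>
    (measurable_pi_apply i).comp h.measurable_ε
  have hcross : ∀ i l, ∫ ω, β ω i * ε ω l ∂P = 0 := fun i l => by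
    have hind : IndepFun (fun ω => β ω i) (fun ω => ε ω l) P :=
      h.indepFun_coef_noise.comp (measurable_pi_apply i) (measurable_pi_apply l)
    rw [hind.integral_fun_mul_eq_mul_integral (hβm i).aestronglyMeasurable
      (hεm l).aestronglyMeasurable, h.β_mean, zero_mul]
  rcases a with i | l <;> rcases b with j | l'
  · simp only [Sum.elim_inl, Sum.inl.injEq]
    split_ifs with hij
    · subst hij
      have := h.β_var i
      rw [variance_of_integral_eq_zero (hβm i).aemeasurable (h.β_mean i)] at this
      simpa only [← sq] using this
    · rw [(h.β_indep.indepFun hij).integral_fun_mul_eq_mul_integral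
        (hβm i).aestronglyMeasurable (hβm j).aestronglyMeasurable, h.β_mean, zero_mul]
  · simp [hcross]
  · simp [mul_comm, hcross]
  · have := h.ε_cov l l'
    rw [covariance, h.ε_mean, h.ε_mean] at this
    simpa using this

/-- The bias and noise matrices have all moments, while β and ε have only second moments;
independence is what makes the products integrable. The first conjunct is the finiteness claim of
the theorem. -/
theorem integral_squaredError_eq_condRisk (h : IsModel P X R β ε α σ) {lam : ℝ}
    (hlam : 0 < lam) :
    Integrable (fun ω => squaredError (X ω) (R ω) (β ω) (ε ω) lam) P ∧
    Integrable (fun ω => condRisk α σ lam (X ω) (R ω)) P ∧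
    ∫ ω, squaredError (X ω) (R ω) (β ω) (ε ω) lam ∂P
      = ∫ ω, condRisk α σ lam (X ω) (R ω) ∂P := by
  have hX := h.measurable_X_apply
  have hR := h.measurable_R_apply
  have hb := finiteMomentsMat_biasMat hlam hX hR h.finiteMomentsMat_X
  have hs := finiteMomentsMat_noiseMat hlam hX hR h.finiteMomentsMat_X
  set M : Ω → Fin p → (Fin p ⊕ Fin n) → ℝ := fun ω j =>
    Sum.elim (biasMat lam (X ω) (R ω) j) (noiseMat lam (X ω) (R ω) j) with hMdef
  set V : Ω → (Fin p ⊕ Fin n) → ℝ := fun ω => Sum.elim (β ω) (ε ω) with hVdef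
  have hMm : ∀ j a, Measurable fun ω => M ω j a := by
    rintro j (i | l)
    · exact measurable_biasMat lam hX hR j i
    · exact measurable_noiseMat lam hX hR j l
  have hMf : ∀ j a, FiniteMoments (fun ω => M ω j a) P := by
    rintro j (i | l)
    · exact hb j i
    · exact hs j l
  have hVm : ∀ a, Measurable fun ω => V ω a := by
    rintro (i | l)
    · exact (measurable_pi_apply i).comp h.measurable_β
    · exact (measurable_pi_apply l).comp h.measurable_ε
  have hV2 : ∀ a, MemLp (fun ω => V ω a) 2 P := by
    rintro (i | l)
    · exact h.β_memLp i
    · exact h.ε_memLp l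
  have hind : IndepFun M V P := by
    refine h.indepFun_design_sketch.comp
      (φ := fun y : Matrix (Fin p) (Fin d) ℝ × Matrix (Fin n) (Fin p) ℝ => fun (j : Fin p) =>
        Sum.elim (biasMat lam y.2 y.1 j) (noiseMat lam y.2 y.1 j))
      (ψ := fun y : (Fin p → ℝ) × (Fin n → ℝ) => Sum.elim y.1 y.2) ?_ ?_
    · have h2 : ∀ i j, Measurable fun y : Matrix (Fin p) (Fin d) ℝ × Matrix (Fin n) (Fin p) ℝ =>
          y.2 i j := fun i j =>
        (measurable_pi_apply j).comp ((measurable_pi_apply i).comp measurable_snd)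
      have h1 : ∀ i j, Measurable fun y : Matrix (Fin p) (Fin d) ℝ × Matrix (Fin n) (Fin p) ℝ =>
          y.1 i j := fun i j =>
        (measurable_pi_apply j).comp ((measurable_pi_apply i).comp measurable_fst)
      refine measurable_pi_lambda _ fun j => measurable_pi_lambda _ ?_
      rintro (i | l)
      · exact measurable_biasMat lam h2 h1 j i
      · exact measurable_noiseMat lam h2 h1 j l
    · refine measurable_pi_lambda _ ?_
      rintro (i | l)
      · exact (measurable_pi_apply i).comp measurable_fst
      · exact (measurable_pi_apply l).comp measurable_snd
  obtain ⟨r1, r2⟩ := integral_sum_sq_of_indepFun hMm hVm hind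
    (fun j a b => ((hMf j a).mul (hMf j b)).integrable) hV2 h.integral_coef_noise_mul
  have i1 : FiniteMoments (fun ω => ∑ j, ∑ i, biasMat lam (X ω) (R ω) j i ^ 2) P :=
    .sum _ fun j => .sum _ fun i => (hb j i).pow 2
  have i2 : FiniteMoments (fun ω => ∑ j, ∑ i, noiseMat lam (X ω) (R ω) j i ^ 2) P :=
    .sum _ fun j => .sum _ fun i => (hs j i).pow 2
  simp only [squaredError_eq]
  refine ⟨r1, ((i1.const_mul _).add (i2.const_mul _)).integrable, r2.trans ?_⟩
  unfold condRisk
  rw [integral_add (i1.const_mul _).integrable (i2.const_mul _).integrable, integral_const_mul,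
    integral_const_mul,
    integral_finsetSum _ fun j _ => (FiniteMoments.sum _ fun i => (hb j i).pow 2).integrable,
    integral_finsetSum _ fun j _ => (FiniteMoments.sum _ fun i => (hs j i).pow 2).integrable,
    Finset.mul_sum, Finset.mul_sum, ← Finset.sum_add_distrib]
  refine Finset.sum_congr rfl fun j _ => ?_
  rw [integral_finsetSum _ fun i _ => ((hb j i).pow 2).integrable,
    integral_finsetSum _ fun i _ => ((hs j i).pow 2).integrable, Fintype.sum_sum_type,
    Finset.mul_sum, Finset.mul_sum]
  rfl

theorem map_columns (h : IsModel P X R β ε α σ) :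
    P.map (fun ω k i => X ω i k) = colNormal (Fin p) (Fin n) := by
  have h1 : iIndepFun (fun (ki : Fin p × Fin n) ω => X ω ki.2 ki.1) P :=
    h.X_indep.precomp (g := Prod.swap) Prod.swap_injective
  have h2 := (iIndepFun_iff_map_fun_eq_pi_map
    fun ki : Fin p × Fin n => (h.measurable_X_apply ki.2 ki.1).aemeasurable).1 h1
  simp only [h.X_gaussian] at h2
  have hm : Measurable fun ω => fun ki : Fin p × Fin n => X ω ki.2 ki.1 :=
    measurable_pi_lambda _ fun ki => h.measurable_X_apply ki.2 ki.1
  rw [← (measurePreserving_curry_stdNormal (κ := Fin p) (ι := Fin n)).map_eq, stdNormal, ← h2,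
    Measure.map_map (MeasurableEquiv.measurable _) hm]
  rfl

/-- By independence, Fubini integrates over X first for a fixed sketch, and that inner integral is
the same for every r with orthonormal columns. The law of R thus disappears. -/
theorem integral_squaredError (h : IsModel P X R β ε α σ) {m : ℕ} (hdm : d + m = p) {lam : ℝ}
    (hlam : 0 < lam) :
    ∫ ω, squaredError (X ω) (R ω) (β ω) (ε ω) lam ∂P
      = ∫ y : (Fin d → Fin n → ℝ) × (Fin m → Fin n → ℝ), splitRisk α σ lam y.1 y.2
        ∂((colNormal (Fin d) (Fin n)).prod (colNormal (Fin m) (Fin n))) := by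
  obtain ⟨-, hi, he⟩ := h.integral_squaredError_eq_condRisk hlam
  rw [he]
  have hR := h.measurable_R
  have hYm : Measurable fun ω => fun (k : Fin p) (i : Fin n) => X ω i k :=
    measurable_pi_lambda _ fun k => measurable_pi_lambda _ fun i => h.measurable_X_apply i k
  have hind : IndepFun (fun ω => fun (k : Fin p) (i : Fin n) => X ω i k) R P := by
    refine ((h.indep_R.comp measurable_id measurable_fst).symm).comp
      (φ := fun x : Matrix (Fin n) (Fin p) ℝ => fun (k : Fin p) (i : Fin n) => x i k)
      (measurable_pi_lambda _ fun k => measurable_pi_lambda _ fun i => ?_) measurable_id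
    exact (measurable_pi_apply k).comp (measurable_pi_apply i)
  have hlaw := (indepFun_iff_map_prod_eq_prod_map_map hYm.aemeasurable hR.aemeasurable).1 hind
  rw [h.map_columns] at hlaw
  set Φ : (Fin p → Fin n → ℝ) × Matrix (Fin p) (Fin d) ℝ → ℝ := fun y =>
    condRisk α σ lam (of fun i k => y.1 k i) y.2 with hΦ
  have hΦm : Measurable Φ := measurable_condRisk α σ lam
    (fun i k => (measurable_pi_apply i).comp ((measurable_pi_apply k).comp measurable_fst))
    (fun i k => (measurable_pi_apply k).comp ((measurable_pi_apply i).comp measurable_snd))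
  have := Measure.isProbabilityMeasure_map (μ := P) hR.aemeasurable
  have e1 : ∫ ω, condRisk α σ lam (X ω) (R ω) ∂P
      = ∫ y, Φ y ∂((colNormal (Fin p) (Fin n)).prod (P.map R)) := by
    rw [← hlaw, integral_map (hYm.prodMk hR).aemeasurable hΦm.aestronglyMeasurable]
    rfl
  have hi2 : Integrable Φ ((colNormal (Fin p) (Fin n)).prod (P.map R)) := by
    rw [← hlaw, integrable_map_measure hΦm.aestronglyMeasurable (hYm.prodMk hR).aemeasurable]
    exact hi
  have hset : MeasurableSet {r : Matrix (Fin p) (Fin d) ℝ | rᵀ * r = 1} := by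
    have : {r : Matrix (Fin p) (Fin d) ℝ | rᵀ * r = 1}
        = ⋂ i, ⋂ j, {r | (rᵀ * r) i j = (1 : Matrix (Fin d) (Fin d) ℝ) i j} := by
      ext r
      simp [← Matrix.ext_iff]
    rw [this]
    have hentry : ∀ i j, Measurable fun r : Matrix (Fin p) (Fin d) ℝ => r i j := fun i j =>
      (measurable_pi_apply j).comp (measurable_pi_apply i)
    exact .iInter fun i => .iInter fun j => measurableSet_eq_fun
      (measurable_mul_apply (fun i j => hentry j i) hentry i j) measurable_const
  rw [e1, integral_prod_symm _ hi2]
  have hae : ∀ᵐ r ∂(P.map R), ∫ y, Φ (y, r) ∂(colNormal (Fin p) (Fin n))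
      = ∫ y : (Fin d → Fin n → ℝ) × (Fin m → Fin n → ℝ), splitRisk α σ lam y.1 y.2
        ∂((colNormal (Fin d) (Fin n)).prod (colNormal (Fin m) (Fin n))) := by
    have h1 : ∀ᵐ r ∂(P.map R), rᵀ * r = 1 := (ae_map_iff hR.aemeasurable hset).2 h.R_orthogonal
    filter_upwards [h1] with r hr
    exact integral_condRisk hdm α σ hlam r hr
  rw [integral_congr_ae hae]
  simp

end IsModel

/-! ### Limits of the resolvent moments -/

section Limits

variable {n d : ℕ → ℕ} {ζ lam : ℝ}

theorem tendsto_integral_sq_stieltjes_sub (hlam : 0 < lam) (hζ : 0 < ζ)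
    (hn : Tendsto n atTop atTop) (hd : Tendsto (fun k => (d k : ℝ) / n k) atTop (𝓝 ζ)) :
    Tendsto (fun k => ∫ z, (stieltjes lam z - mpRoot ζ lam) ^ 2
      ∂(colNormal (Fin (d k)) (Fin (n k)))) atTop (𝓝 0) := by
  have hnr : Tendsto (fun k => (n k : ℝ)) atTop atTop := tendsto_natCast_atTop_atTop.comp hn
  have t1 : Tendsto (fun k => |kurt - 1| / (lam ^ 2 * (n k : ℝ))) atTop (𝓝 0) :=
    tendsto_const_nhds.div_atTop (hnr.const_mul_atTop (by positivity))
  have t2 : Tendsto (fun k => 1 / (lam * (n k : ℝ))) atTop (𝓝 0) :=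
    tendsto_const_nhds.div_atTop (hnr.const_mul_atTop hlam)
  have t3 : Tendsto (fun k => (lam ^ 2)⁻¹ * (2 * ((d k : ℝ) / n k) ^ 2
      * (2 * (|kurt - 1| / (lam ^ 2 * n k)) + 2 * (1 / (lam * n k)) ^ 2)
        + 2 * ((d k : ℝ) / n k - ζ) ^ 2)) atTop (𝓝 0) := by
    have := ((((hd.pow 2).const_mul 2).mul ((t1.const_mul 2).add ((t2.pow 2).const_mul 2))).add
      (((hd.sub_const ζ).pow 2).const_mul 2)).const_mul ((lam ^ 2)⁻¹)
    simpa using this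
  refine squeeze_zero' (Eventually.of_forall fun k => integral_nonneg fun z => sq_nonneg _) ?_ t3
  filter_upwards [hn.eventually_gt_atTop 0, hd.eventually_const_lt hζ] with k hk hdk
  have : Nonempty (Fin (n k)) := ⟨⟨0, hk⟩⟩
  have hd0 : d k ≠ 0 := by
    intro h
    simp [h] at hdk
  have h := integral_sq_stieltjes_sub_le (ι := Fin (n k)) hd0 hlam hζ.le (mpRoot_pos hlam).le
    (mpRoot_fixedPoint hlam)
  rw [Fintype.card_fin] at h
  rw [← div_eq_inv_mul, le_div_iff₀ (by positivity), mul_comm]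
  exact h

theorem tendsto_integral_stieltjes (hlam : 0 < lam) (hζ : 0 < ζ)
    (hn : Tendsto n atTop atTop) (hd : Tendsto (fun k => (d k : ℝ) / n k) atTop (𝓝 ζ)) :
    Tendsto (fun k => ∫ z, stieltjes lam z ∂(colNormal (Fin (d k)) (Fin (n k)))) atTop
      (𝓝 (mpRoot ζ lam)) ∧
    Tendsto (fun k => ∫ z, stieltjes lam z ^ 2 ∂(colNormal (Fin (d k)) (Fin (n k)))) atTop
      (𝓝 (mpRoot ζ lam ^ 2)) := by
  have hD := tendsto_integral_sq_stieltjes_sub hlam hζ hn hd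
  have hexp : ∀ k (c : ℝ), ∫ z, (stieltjes lam z - c) ^ 2 ∂(colNormal (Fin (d k)) (Fin (n k)))
      = (∫ z, stieltjes lam z ^ 2 ∂(colNormal (Fin (d k)) (Fin (n k))))
        - 2 * c * (∫ z, stieltjes lam z ∂(colNormal (Fin (d k)) (Fin (n k)))) + c ^ 2 := by
    intro k c
    have h := finiteMoments_stieltjes (κ := Fin (d k)) (ι := Fin (n k)) hlam
    have e : ∀ z : Fin (d k) → Fin (n k) → ℝ, (stieltjes lam z - c) ^ 2
        = stieltjes lam z ^ 2 - 2 * c * stieltjes lam z + c ^ 2 := fun z => by ring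
    simp only [e]
    rw [integral_add ((h.pow 2).sub (h.const_mul _)).integrable (integrable_const _),
      integral_sub (h.pow 2).integrable (h.const_mul _).integrable, integral_const_mul]
    simp
  have h1 : Tendsto (fun k => ∫ z, stieltjes lam z ∂(colNormal (Fin (d k)) (Fin (n k)))) atTop
      (𝓝 (mpRoot ζ lam)) := by
    rw [tendsto_iff_dist_tendsto_zero]
    have hs := (Real.continuous_sqrt.tendsto 0).comp hD
    rw [Real.sqrt_zero] at hs
    refine squeeze_zero (fun k => dist_nonneg) (fun k => ?_) hs
    rw [Real.dist_eq]
    refine Real.abs_le_sqrt ?_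
    -- Nonnegativity of the variance says that the squared distance of the mean from `mpRoot` is at
    -- most the mean squared distance.
    have hvar : 0 ≤ ∫ z, (stieltjes lam z
        - ∫ z, stieltjes lam z ∂(colNormal (Fin (d k)) (Fin (n k)))) ^ 2
        ∂(colNormal (Fin (d k)) (Fin (n k))) := integral_nonneg fun z => sq_nonneg _
    simp only [hexp] at hvar ⊢
    nlinarith
  refine ⟨h1, ?_⟩
  -- Uses E s² = E (s - m)² + 2 m E s - m².
  have h2 := (hD.add (h1.const_mul (2 * mpRoot ζ lam))).sub_const (mpRoot ζ lam ^ 2)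
  have e : 0 + 2 * mpRoot ζ lam * mpRoot ζ lam - mpRoot ζ lam ^ 2 = mpRoot ζ lam ^ 2 := by ring
  rw [e] at h2
  refine h2.congr fun k => ?_
  rw [hexp]
  ring

theorem abs_integral_stieltjes_sub_le {ι κ : Type*} [Fintype ι] [Fintype κ] [DecidableEq ι]
    [Nonempty ι] (hlam : 0 < lam) {mu : ℝ} (hmu : lam < mu) :
    |(∫ z, stieltjes lam z ∂(colNormal κ ι)) - (∫ z, stieltjes mu z ∂(colNormal κ ι))
      - (mu - lam) * ∫ z, stieltjesSq lam z ∂(colNormal κ ι)|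
      ≤ (mu - lam) ^ 2 * (1 / (lam ^ 2 * lam)) := by
  have hmu0 := hlam.trans hmu
  have hn : (0 : ℝ) < Fintype.card ι := by exact_mod_cast Fintype.card_pos
  have i1 := finiteMoments_stieltjes (κ := κ) (ι := ι) hlam
  have i2 := finiteMoments_stieltjes (κ := κ) (ι := ι) hmu0
  have i3 := finiteMoments_stieltjesSq (κ := κ) (ι := ι) hlam
  rw [← integral_const_mul, ← integral_sub i1.integrable i2.integrable,
    ← integral_sub (i1.sub i2).integrable (i3.const_mul _).integrable, ← Real.norm_eq_abs]
  refine (norm_integral_le_of_norm_le_const (C := (mu - lam) ^ 2 * (1 / (lam ^ 2 * lam)))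
    (ae_of_all _ fun z => ?_)).trans (by simp)
  have h := trace_resolvent_sub (posSemidef_gram z) hlam hmu0
  have e : stieltjes lam z - stieltjes mu z - (mu - lam) * stieltjesSq lam z
      = ((resolvent (gram z) lam).trace - (resolvent (gram z) mu).trace
        - (mu - lam) * (resolvent (gram z) lam * resolvent (gram z) lam).trace)
          / Fintype.card ι := by
    simp only [stieltjes, stieltjesSq]
    ring
  rw [e, Real.norm_eq_abs, abs_div, abs_of_pos hn, div_le_iff₀ hn]
  refine h.trans ?_
  rw [mul_assoc, one_div_mul_eq_div]
  gcongr

/-- The limit of the mean of s is known at every `mu ≥ lam`, and uniform Taylor bounds on both sides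
transfer it to the slopes at `lam`. -/
theorem tendsto_integral_stieltjesSq (hlam : 0 < lam) (hζ : 0 < ζ)
    (hn : Tendsto n atTop atTop) (hd : Tendsto (fun k => (d k : ℝ) / n k) atTop (𝓝 ζ)) :
    Tendsto (fun k => ∫ z, stieltjesSq lam z ∂(colNormal (Fin (d k)) (Fin (n k)))) atTop
      (𝓝 (thetaBar 2 ζ lam)) := by
  obtain ⟨C, hC, hC'⟩ := exists_thetaBar_sub_le hζ hlam
  refine tendsto_of_slope_bound
    (f := fun k mu => ∫ z, stieltjes mu z ∂(colNormal (Fin (d k)) (Fin (n k))))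
    (g := fun mu => thetaBar 1 ζ mu) (lam := lam) (C := 1 / (lam ^ 2 * lam)) (C' := C)
    (by positivity) hC ?_ hC' fun mu hmu => ?_
  · filter_upwards [hn.eventually_gt_atTop 0] with k hk mu hmu
    have : Nonempty (Fin (n k)) := ⟨⟨0, hk⟩⟩
    exact abs_integral_stieltjes_sub_le hlam hmu
  · have hmu0 := hlam.trans_le hmu
    simp only [thetaBar_one_eq hζ hmu0]
    exact (tendsto_integral_stieltjes hmu0 hζ hn hd).1

end Limits

end DualSketch
-- The limit of the mean squared error
theorem theorem4
    (Ω : ℕ → Type*) [∀ k, MeasurableSpace (Ω k)]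
    (P : ∀ k, Measure (Ω k)) [∀ k, IsProbabilityMeasure (P k)]
    (n p d : ℕ → ℕ) (γ ζ α σ lam : ℝ)
    (hlam : 0 < lam) (hζ : 0 < ζ) (hζγ : ζ < γ)
    (hn : Tendsto n atTop atTop)
    (hp : Tendsto (fun k => (p k : ℝ) / n k) atTop (𝓝 γ))
    (hd : Tendsto (fun k => (d k : ℝ) / n k) atTop (𝓝 ζ))
    (X : ∀ k, Ω k → Matrix (Fin (n k)) (Fin (p k)) ℝ)
    (R : ∀ k, Ω k → Matrix (Fin (p k)) (Fin (d k)) ℝ)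
    (β : ∀ k, Ω k → Fin (p k) → ℝ)
    (ε : ∀ k, Ω k → Fin (n k) → ℝ)
    (hmodel : ∀ k, DualSketch.IsModel (P k) (X k) (R k) (β k) (ε k) α σ) :
    (∀ k, Integrable
      (fun ω => DualSketch.squaredError (X k ω) (R k ω) (β k ω) (ε k ω) lam) (P k)) ∧
    Tendsto
      (fun k => ∫ ω, DualSketch.squaredError (X k ω) (R k ω) (β k ω) (ε k ω) lam ∂(P k))
      atTop
      (𝓝 (α ^ 2 / γ *
            (γ - 1 + (lam - γ + ζ) ^ 2 * DualSketch.thetaBar 2 ζ lam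
              + (γ - ζ) * (DualSketch.thetaBar 1 ζ lam) ^ 2)
          + σ ^ 2 *
            (DualSketch.thetaBar 1 ζ lam
              - (lam + ζ - γ) * DualSketch.thetaBar 2 ζ lam))) := by
  refine ⟨fun k => ((hmodel k).integral_squaredError_eq_condRisk hlam).1, ?_⟩
  obtain ⟨t1, t2⟩ := DualSketch.tendsto_integral_stieltjes hlam hζ hn hd
  have t3 := DualSketch.tendsto_integral_stieltjesSq hlam hζ hn hd
  rw [← DualSketch.thetaBar_one_eq hζ hlam] at t1 t2
  have hγ : γ ≠ 0 := (hζ.trans hζγ).ne'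
  have hnr : Tendsto (fun k => (n k : ℝ)) atTop atTop := tendsto_natCast_atTop_atTop.comp hn
  -- The only trace of the fourth moment in the exact risk; it is of order 1/n.
  have hκ : Tendsto (fun k => (DualSketch.kurt - 2) / (n k : ℝ)) atTop (𝓝 0) :=
    tendsto_const_nhds.div_atTop hnr
  have hM := hp.sub hd
  have hq : Tendsto (fun k => α ^ 2 / ((p k : ℝ) / n k)) atTop (𝓝 (α ^ 2 / γ)) :=
    tendsto_const_nhds.div hp hγ
  have hlim := (hq.mul (((hp.sub_const 1).add
    ((((tendsto_const_nhds (x := lam ^ 2)).sub (hM.const_mul (2 * lam))).add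
      (hM.mul (hM.add hκ))).mul t3)).add (hM.mul t2))).add
    ((t1.add ((hM.sub_const lam).mul t3)).const_mul (σ ^ 2))
  refine Tendsto.congr' ?_ (hlim.trans (le_of_eq ?_))
  -- Once n and p are positive, dividing the exact risk formula through by n gives the expression
  -- whose limit was taken, with m/n = p/n - d/n.
  · filter_upwards [hn.eventually_gt_atTop 0, hp.eventually_const_lt (hζ.trans hζγ)] with k hk hpk
    have : Nonempty (Fin (n k)) := ⟨⟨0, hk⟩⟩
    have hn0 : (n k : ℝ) ≠ 0 := by exact_mod_cast hk.ne'
    have hp0 : (p k : ℝ) ≠ 0 := fun h => by simp [h] at hpk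
    have hdp := (hmodel k).sketch_dim_le
    have hdm : d k + (p k - d k) = p k := Nat.add_sub_cancel' hdp
    rw [(hmodel k).integral_squaredError hdm hlam, DualSketch.integral_splitRisk α σ hlam]
    simp only [Fintype.card_fin, Nat.cast_sub hdp, add_sub_cancel]
    field_simp
    ring
  · congr 1
    ring
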